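/- **Theorem (Trotter error of multi-product formulas).** Let $F_1,\dots,F_d$ be Hermitian operators on a finite-dimensional Hilbert space, $H=\sum_{a=1}^d F_a$, and let $\mathcal S(t)=e^{-itF_d}\cdots e^{-itF_1}$ be a product formula of order $p\ge 1$, i.e. $\mathcal S(t)=e^{-itH}+O(t^{p+1})$ as $t\to0$. For a density operator $\rho_{in}$ put $\rho(t)=e^{-itH}\rho_{in}e^{itH}$ and $\rho_k(t)=\mathcal S(t/k)^k\rho_{in}\mathcal S(t/k)^{-k}$. Let $k_1,\dots,k_{p+1}\ge1$ be integers, $k_{min}=\min_i k_i$, and let $c_1,\dots,c_{p+1}\in\mathbb R$ satisfy $\sum_i c_i=1$ and $\sum_i c_i/k_i^q=0$ for $q=p,p+1,\dots,2p-1$. Put $\mu(t)=\sum_{i=1}^{p+1}c_i\rho_{k_i}(t)$. Write $\mathrm{Ad}_X(Y)=XY-YX$, $\hat U(X)=UXU^{-1}$, $\Gamma(t)=\{e^{-i\tau_dF_d}\cdots e^{-i\tau_1F_1}: 0\le\tau_1,\dots,\tau_d\le t\}$, let $\|\cdot\|$ be the operator norm and $\|\cdot\|_1$ the trace norm, and define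 $$\alpha_p=\sum_{a=2}^d\ \sum_{q_a+\dots+q_d=p}\frac{p!}{q_a!\cdots q_d!}\,\bigl\|(\mathrm{Ad}_{F_d})^{q_d}\cdots(\mathrm{Ad}_{F_a})^{q_a}(F_{a-1})\bigr\|,$$ $$\beta_{n,\ell}(t)=\sum_{a=2}^d\ \sum_{q_a+\dots+q_d=n}\frac{n!}{q_a!\cdots q_d!}\,\max_{U\in\Gamma(t)}\bigl\|(\mathrm{Ad}_H)^{\ell}\,\hat U\,(\mathrm{Ad}_{F_d})^{q_d}\cdots(\mathrm{Ad}_{F_a})^{q_a}(F_{a-1})\bigr\|,$$ $$\beta^H_{n,\ell}(t)=\sum_{j=0}^n\binom nj\beta_{n-j,\ell+j}(t).$$ ($\beta^H_{n,\ell}$ is the analogue of $\beta_{n,\ell}$ in which $H$ is added to the list $F_d,\dots,F_a$.) For $b=\beta$ and for $b=\beta^H$ let $$a_1=8\Bigl(\frac{\alpha_p}{(p+1)!}\Bigr)^2,\qquad a_2[b]=\frac{4\,b_{2p,0}(0)}{(2p)!}+\frac{8\,b_{p,p}(t/k_{min})}{(2\pi)^p\,p!},\qquad a_3[b]=4\sum_{\ell=1}^p\frac{|B_\ell|\;b_{2p-\ell,\ell-1}(t/k_{min})}{\ell!\,(2p-\ell)!},$$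 where $B_\ell$ is the $\ell$-th Bernoulli number, and let $$a_3^{odd}=4\sum_{\substack{3\le\ell<p\\ \ell\ \mathrm{odd}}}\frac{\max_{0\le x\le1}|B_\ell(x)|\;\beta_{2p-\ell,\ell-1}(t/k_{min})}{\ell!\,(2p-\ell)!},$$ where $B_\ell(x)$ is the $\ell$-th Bernoulli polynomial (so $a_3^{odd}=0$ for $p\le3$). Then for every $t\ge0$ both $$\|\mu(t)-\rho(t)\|_1\le\Bigl(\sum_{i=1}^{p+1}\frac{|c_i|}{k_i^{2p}}\Bigr)\Bigl(a_1t^{2p+2}+a_2[\beta]\,t^{2p+1}+\bigl(a_3[\beta]+a_3^{odd}\bigr)t^{2p}\Bigr)$$ and $$\|\mu(t)-\rho(t)\|_1\le\Bigl(\sum_{i=1}^{p+1}\frac{|c_i|}{k_i^{2p}}\Bigr)\Bigl(a_1t^{2p+2}+a_2[\beta^H]\,t^{2p+1}+a_3[\beta^H]\,t^{2p}\Bigr).$$ -/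

import Mathlib

open Filter Topology Asymptotics

noncomputable section

namespace MPF

variable {E : Type*} [NormedAddCommGroup E] [InnerProductSpace ℂ E]

/-- The trace norm `‖X‖₁` of an operator on a finite-dimensional Hilbert space: the sum of its
singular values, counted with multiplicity. -/
def traceNorm [FiniteDimensional ℂ E] (X : E →L[ℂ] E) : ℝ :=
  ∑ i ∈ Finset.range (Module.finrank ℂ E), (X : E →ₗ[ℂ] E).singularValues i

/-- Density operators: positive semidefinite with unit trace. -/
def IsDensity (ρ : E →L[ℂ] E) : Prop :=
  ρ.IsPositive ∧ LinearMap.trace ℂ E (ρ : E →ₗ[ℂ] E) = 1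

/-- The one-parameter group `e^{-itX}`. -/
def evol (X : E →L[ℂ] E) (t : ℝ) : E →L[ℂ] E :=
  NormedSpace.exp ((-(Complex.I * (t : ℂ))) • X)

/-- Conjugation `Û(X) = U X U⁻¹`; it is only used for invertible `U`. -/
def conj (U X : E →L[ℂ] E) : E →L[ℂ] E := U * X * Ring.inverse U

/-- The adjoint action `Ad_X(Y) = XY - YX`, as a linear map on operators. -/
def Ad (X : E →L[ℂ] E) : Module.End ℂ (E →L[ℂ] E) :=
  LinearMap.mulLeft ℂ X - LinearMap.mulRight ℂ X

variable {d : ℕ}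

/-- `e^{-iτ_d F_d} ⋯ e^{-iτ_2 F_2} e^{-iτ_1 F_1}`. The operators `F_1, …, F_d` are stored as
`F 0, …, F (d - 1)`. -/
def orderedExp (F : Fin d → E →L[ℂ] E) (τ : Fin d → ℝ) : E →L[ℂ] E :=
  (List.ofFn fun j : Fin d => evol (F j.rev) (τ j.rev)).prod

/-- The Hamiltonian `H = F_1 + ⋯ + F_d`. -/
def ham (F : Fin d → E →L[ℂ] E) : E →L[ℂ] E := ∑ a, F a

/-- The product formula `S(t) = e^{-itF_d} ⋯ e^{-itF_2} e^{-itF_1}`. -/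
def prodFormula (F : Fin d → E →L[ℂ] E) (t : ℝ) : E →L[ℂ] E := orderedExp F fun _ => t

/-- `S` has order `p`: `S(t) = e^{-itH} + O(t^{p+1})` as `t → 0`. -/
def HasOrder (F : Fin d → E →L[ℂ] E) (p : ℕ) : Prop :=
  (fun t : ℝ => prodFormula F t - evol (ham F) t) =O[𝓝 0] fun t : ℝ => t ^ (p + 1)

/-- The exact time-evolved state `ρ(t) = e^{-itH} ρ_in e^{itH}`. -/
def exactState (F : Fin d → E →L[ℂ] E) (ρin : E →L[ℂ] E) (t : ℝ) : E →L[ℂ] E :=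
  evol (ham F) t * ρin * evol (ham F) (-t)

/-- The state after `k` steps, `ρ_k(t) = S(t/k)^k ρ_in S(t/k)^{-k}`. -/
def trotterState (F : Fin d → E →L[ℂ] E) (ρin : E →L[ℂ] E) (k : ℕ) (t : ℝ) : E →L[ℂ] E :=
  conj (prodFormula F (t / k) ^ k) ρin

/-- The multi-product formula `μ(t) = ∑ c_i ρ_{k_i}(t)`. -/
def mpf {r : ℕ} (F : Fin d → E →L[ℂ] E) (ρin : E →L[ℂ] E) (k : Fin r → ℕ) (c : Fin r → ℝ)
    (t : ℝ) : E →L[ℂ] E :=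
  ∑ i, (c i : ℂ) • trotterState F ρin (k i) t

/-- `(Ad_{F_d})^{q_d} ⋯ (Ad_{F_2})^{q_2} (Ad_{F_1})^{q_1} (B)`. -/
def nestedComm (F : Fin d → E →L[ℂ] E) (q : Fin d → ℕ) (B : E →L[ℂ] E) : E →L[ℂ] E :=
  (List.ofFn fun j : Fin d => Ad (F j.rev) ^ q j.rev).prod B

/-- The indices `a - 1` with `2 ≤ a ≤ d`, that is, all indices of the family but the last. -/
def innerIdx (d : ℕ) : Finset (Fin d) := Finset.univ.filter fun b => (b : ℕ) + 1 < d

/-- `α_n = ∑_{a=2}^d ∑_{q_a + ⋯ + q_d = n} n!/(q_a! ⋯ q_d!)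
‖(Ad_{F_d})^{q_d} ⋯ (Ad_{F_a})^{q_a} (F_{a-1})‖`. -/
def alpha (F : Fin d → E →L[ℂ] E) (n : ℕ) : ℝ :=
  ∑ b ∈ innerIdx d, ∑ q ∈ Finset.piAntidiag (Finset.Ioi b) n,
    (Nat.multinomial (Finset.Ioi b) q : ℝ) * ‖nestedComm F q (F b)‖

/-- `max_{U ∈ Γ(t)} ‖(Ad_H)^ℓ Û (X)‖`, where `Γ(t)` is the set of the unitaries
`e^{-iτ_d F_d} ⋯ e^{-iτ_1 F_1}` with `0 ≤ τ_1, …, τ_d ≤ t` (and `t ≥ 0`). -/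
def maxNorm (F : Fin d → E →L[ℂ] E) (ℓ : ℕ) (t : ℝ) (X : E →L[ℂ] E) : ℝ :=
  ⨆ τ : {τ : Fin d → ℝ // ∀ a, τ a ∈ Set.Icc 0 t},
    ‖(Ad (ham F) ^ ℓ) (conj (orderedExp F τ) X)‖

/-- `β_{n,ℓ}(t) = ∑_{a=2}^d ∑_{q_a + ⋯ + q_d = n} n!/(q_a! ⋯ q_d!)
max_{U ∈ Γ(t)} ‖(Ad_H)^ℓ Û (Ad_{F_d})^{q_d} ⋯ (Ad_{F_a})^{q_a} (F_{a-1})‖`. -/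
def beta (F : Fin d → E →L[ℂ] E) (n ℓ : ℕ) (t : ℝ) : ℝ :=
  ∑ b ∈ innerIdx d, ∑ q ∈ Finset.piAntidiag (Finset.Ioi b) n,
    (Nat.multinomial (Finset.Ioi b) q : ℝ) * maxNorm F ℓ t (nestedComm F q (F b))

/-- The analogue of `β_{n,ℓ}(t)` for the list `H, F_d, …, F_a`:
`∑_{a=2}^d ∑_{j + q_a + ⋯ + q_d = n} n!/(j! q_a! ⋯ q_d!)
max_{U ∈ Γ(t)} ‖(Ad_H)^{ℓ+j} Û (Ad_{F_d})^{q_d} ⋯ (Ad_{F_a})^{q_a} (F_{a-1})‖`. -/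
def betaH (F : Fin d → E →L[ℂ] E) (n ℓ : ℕ) (t : ℝ) : ℝ :=
  ∑ j ∈ Finset.range (n + 1), (n.choose j : ℝ) * beta F (n - j) (ℓ + j) t

/-- `max_{0 ≤ x ≤ 1} |B_ℓ(x)|` for the Bernoulli polynomial `B_ℓ(x)`. -/
def bernoulliMax (ℓ : ℕ) : ℝ := ⨆ x : Set.Icc (0 : ℝ) 1, |bernoulliFun ℓ x|

/-- `a_1 = 8 (α_p/(p+1)!)²`. -/
def a₁ (F : Fin d → E →L[ℂ] E) (p : ℕ) : ℝ := 8 * (alpha F p / (p + 1).factorial) ^ 2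

/-- `a_2 = 4 b_{2p,0}(0)/(2p)! + 8 b_{p,p}(s)/((2π)^p p!)` for the commutator norms `b`. -/
def a₂ (b : ℕ → ℕ → ℝ → ℝ) (p : ℕ) (s : ℝ) : ℝ :=
  4 * b (2 * p) 0 0 / (2 * p).factorial + 8 * b p p s / ((2 * Real.pi) ^ p * p.factorial)

/-- `a_3 = 4 ∑_{ℓ=1}^p |B_ℓ| b_{2p-ℓ,ℓ-1}(s)/(ℓ! (2p-ℓ)!)` for the commutator norms `b`. -/
def a₃ (b : ℕ → ℕ → ℝ → ℝ) (p : ℕ) (s : ℝ) : ℝ :=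
  4 * ∑ ℓ ∈ Finset.Icc 1 p, |((bernoulli ℓ : ℚ) : ℝ)| * b (2 * p - ℓ) (ℓ - 1) s /
    (ℓ.factorial * (2 * p - ℓ).factorial)

/-- The terms with odd `ℓ`, `3 ≤ ℓ < p`, for which the Bernoulli number vanishes but the
Bernoulli polynomial does not. There are none for `p ≤ 3`. -/
def a₃odd (b : ℕ → ℕ → ℝ → ℝ) (p : ℕ) (s : ℝ) : ℝ :=
  4 * ∑ ℓ ∈ (Finset.Ico 3 p).filter Odd, bernoulliMax ℓ * b (2 * p - ℓ) (ℓ - 1) s /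
    (ℓ.factorial * (2 * p - ℓ).factorial)

end MPF

end

namespace MPF

/-! In the interaction picture one step is `stepOp F h`, that is `e^{ihH} S(h)`, generated by
`errOp`: write `S'(s) = -i (H + E(s)) S(s)` with `E = errOp F`. Since `S` has order `p`, the Taylor
coefficients of `E` below order `p` vanish (`errCoeff_eq_zero`), so `E(s) = O(s^p)`, and `k` steps
of length `h = t/k` give `X = 1 - iY + O(ε²)` with `ε = k α_p h^{p+1}/(p+1)!`
(`norm_stepsOp_sub_one_le`). Duality between trace norm and operator norm moves the error onto an
observable `W'` with `‖W'‖ ≤ 1`. Terms quadratic in `ε` already carry `1/k^{2p}` and yield `a₁`;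
what is left is twice the norm of the weighted first-order term `∑ c_i Y_i`
(`traceNorm_mpf_sub_exactState_le`).

With `φ_s = e^{is Ad_H}`, the operator `Y` is the sum of the integrals of `φ_s` applied to `E(s -
jh)` over the steps `[jh, (j+1)h]`. Substituting `s = (j+x)h` makes it an integral over `x ∈ [0,1]`
of rectangle sums `h ∑_j φ_{(j+x)h}(E(xh))`. For fixed `x` the Euler–Maclaurin formula
(`norm_sum_orbit_sub_le`) turns each sum into an integral over `[0,t]`, boundary terms with factors
`h^l B_l(x)/l!`, and a remainder with factor `h^p`. The integral and the boundary terms are linear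
in `h^l E(xh)`, so expanding `E` produces only powers of `h` from `p` on, and the order conditions
cancel those from `p` to `2p-1` (`norm_map_sum_smul_le`). The Euler–Maclaurin remainder needs no
cancellation: it has `h^p` from the quadrature and `(xh)^p` from `E`. These three contributions are
assembled in `norm_integral_sum_orbit_le`.

The remaining Taylor remainders are measured by `beta`; `norm_map_conj_orderedExp_sub_taylor_le`
proves this by peeling off one exponential at a time. The two bounds of the theorem differ only in
how `φ_{(j+x)h}(E(xh))` is read: as a sample at `(j+x)h` of the orbit of `E(xh)`, which brings in
`B_l(x)`, or as a sample at `jh` of the orbit of `φ_{xh}(E(xh))`, which brings in `B_l(0)` at the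
price of also expanding `φ`, hence `betaH`. -/

theorem hasDerivAt_pow_succ_div_factorial (p : ℕ) (s : ℝ) :
    HasDerivAt (fun s : ℝ => s ^ (p + 1) / (p + 1).factorial) (s ^ p / p.factorial) s := by
  refine ((hasDerivAt_pow (p + 1) s).div_const ((p + 1).factorial : ℝ)).congr_deriv ?_
  have : (p.factorial : ℝ) ≠ 0 := by positivity
  rw [Nat.factorial_succ]
  push_cast
  field_simp

/-! ### Taylor and Euler–Maclaurin formulas for vector-valued functions -/

section Jets

variable {V : Type*} [NormedAddCommGroup V] [NormedSpace ℝ V]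

/-- Taylor's formula with the sharp remainder bound, for a function given together with the
sequence `f 0, f 1, f 2, …` of its derivatives. -/
theorem norm_sub_taylor_le (n : ℕ) (f : ℕ → ℝ → V)
    (hf : ∀ m s, HasDerivAt (f m) (f (m + 1) s) s) {s C : ℝ} (hs : 0 ≤ s)
    (hC : ∀ σ ∈ Set.Icc 0 s, ‖f n σ‖ ≤ C) :
    ‖f 0 s - ∑ j ∈ Finset.range n, (s ^ j / j.factorial) • f j 0‖ ≤
      C * s ^ n / n.factorial := by
  induction n generalizing f s with
  | zero => simpa using hC s ⟨hs, le_rfl⟩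
  | succ n ih =>
    have key : ∀ σ ∈ Set.Icc 0 s,
        ‖f 1 σ - ∑ j ∈ Finset.range n, (σ ^ j / j.factorial) • f (j + 1) 0‖ ≤
          C * σ ^ n / n.factorial := fun σ hσ =>
      ih (fun m => f (m + 1)) (fun m => hf (m + 1)) hσ.1
        fun τ hτ => hC τ ⟨hτ.1, hτ.2.trans hσ.2⟩
    have hder : ∀ σ : ℝ, HasDerivAt
        (fun σ => f 0 σ - ∑ j ∈ Finset.range (n + 1), (σ ^ j / j.factorial) • f j 0)
        (f 1 σ - ∑ j ∈ Finset.range n, (σ ^ j / j.factorial) • f (j + 1) 0) σ := by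
      intro σ
      simp only [Finset.sum_range_succ']
      have h1 : HasDerivAt (fun σ : ℝ =>
          ∑ j ∈ Finset.range n, (σ ^ (j + 1) / (j + 1).factorial) • f (j + 1) 0)
          (∑ j ∈ Finset.range n, (σ ^ j / j.factorial) • f (j + 1) 0) σ :=
        HasDerivAt.fun_sum fun j _ => (hasDerivAt_pow_succ_div_factorial j σ).smul_const _
      simpa using (hf 0 σ).fun_sub (h1.add_const (f 0 0))
    -- A bound on the derivative of the remainder is integrated by comparison with a scalar
    -- majorant, so no integral has to be computed.
    refine image_norm_le_of_norm_deriv_right_le_deriv_boundary (a := 0) (b := s)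
      (B := fun σ => C * σ ^ (n + 1) / (n + 1).factorial) (B' := fun σ => C * σ ^ n / n.factorial)
      (fun σ _ => (hder σ).continuousAt.continuousWithinAt)
      (fun σ _ => (hder σ).hasDerivWithinAt) ?_ (fun σ => ?_)
      (fun σ hσ => key σ ⟨hσ.1, hσ.2.le⟩) ⟨hs, le_rfl⟩
    · simp [Finset.sum_range_succ']
    · simpa [mul_div_assoc] using (hasDerivAt_pow_succ_div_factorial n σ).const_mul C

/-- Convolution with the periodized Bernoulli polynomial over one period. -/
noncomputable def bernoulliConv (n : ℕ) (g : ℝ → V) (x : ℝ) : V :=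
  (∫ s in (0 : ℝ)..x, bernoulliFun n (x - s) • g s) +
    ∫ s in x..1, bernoulliFun n (1 + x - s) • g s

/-- The two pieces of the convolution live on intervals of lengths `x` and `1 - x`, which add up to
one. -/
theorem norm_bernoulliConv_le {n : ℕ} {g : ℝ → V} {x M C : ℝ} (hx : x ∈ Set.Icc (0 : ℝ) 1)
    (hM : ∀ y ∈ Set.Icc (0 : ℝ) 1, |bernoulliFun n y| ≤ M)
    (hC : ∀ s ∈ Set.Icc (0 : ℝ) 1, ‖g s‖ ≤ C) : ‖bernoulliConv n g x‖ ≤ M * C := by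
  have hM0 : 0 ≤ M := (abs_nonneg _).trans (hM x hx)
  have h1 : ‖∫ s in (0 : ℝ)..x, bernoulliFun n (x - s) • g s‖ ≤ M * C * |x - 0| := by
    refine intervalIntegral.norm_integral_le_of_norm_le_const fun s hs => ?_
    rw [Set.uIoc_of_le hx.1] at hs
    rw [norm_smul]
    exact mul_le_mul (hM _ ⟨by linarith [hs.2], by linarith [hs.1, hx.2]⟩)
      (hC s ⟨hs.1.le, hs.2.trans hx.2⟩) (norm_nonneg _) hM0
  have h2 : ‖∫ s in x..1, bernoulliFun n (1 + x - s) • g s‖ ≤ M * C * |1 - x| := by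
    refine intervalIntegral.norm_integral_le_of_norm_le_const fun s hs => ?_
    rw [Set.uIoc_of_le hx.2] at hs
    rw [norm_smul]
    exact mul_le_mul (hM _ ⟨by linarith [hs.2, hx.1], by linarith [hs.1]⟩)
      (hC s ⟨hx.1.trans hs.1.le, hs.2⟩) (norm_nonneg _) hM0
  rw [abs_of_nonneg (by linarith [hx.1])] at h1
  rw [abs_of_nonneg (by linarith [hx.2])] at h2
  exact (norm_add_le _ _).trans (by linarith)

variable [CompleteSpace V]

/-- Integration by parts, using `B_{n+1}' = (n+1) B_n`. -/
theorem integral_bernoulliFun_sub_smul (n : ℕ) {g g' : ℝ → V}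
    (hg : ∀ s, HasDerivAt g (g' s) s) (hg' : Continuous g') (y a b : ℝ) :
    ∫ s in a..b, bernoulliFun n (y - s) • g s =
      (1 / (n + 1 : ℝ)) • (bernoulliFun (n + 1) (y - a) • g a - bernoulliFun (n + 1) (y - b) • g b
        + ∫ s in a..b, bernoulliFun (n + 1) (y - s) • g' s) := by
  have hB : ∀ s : ℝ, HasDerivAt (fun s => bernoulliFun (n + 1) (y - s))
      (-((n + 1 : ℝ) * bernoulliFun n (y - s))) s := by
    intro s
    have h := (hasDerivAt_bernoulliFun (n + 1) (y - s)).comp s ((hasDerivAt_id s).const_sub y)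
    simpa [Function.comp_def] using h
  have hibp := intervalIntegral.integral_smul_deriv_eq_deriv_smul (a := a) (b := b)
    (fun s _ => hB s) (fun s _ => hg s)
    (Continuous.intervalIntegrable (by fun_prop) _ _) (hg'.intervalIntegrable _ _)
  have hn : (n + 1 : ℝ) ≠ 0 := by positivity
  rw [hibp]
  simp only [neg_smul, mul_smul, intervalIntegral.integral_neg, intervalIntegral.integral_smul]
  rw [show ∀ u v w : V, u - v + (v - u - -((n + 1 : ℝ) • w)) = (n + 1 : ℝ) • w by
    intros; abel, smul_smul, one_div, inv_mul_cancel₀ hn, one_smul]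

/-- Integration by parts on both pieces. The boundary terms at `s = x` cancel, because `B_{n+1}`
agrees at `0` and `1`, except for `n = 0`, where the unit jump of `B_1` reproduces `g x`. -/
theorem bernoulliConv_eq (n : ℕ) {g g' : ℝ → V}
    (hg : ∀ s, HasDerivAt g (g' s) s) (hg' : Continuous g') (x : ℝ) :
    bernoulliConv n g x = (1 / (n + 1 : ℝ)) • ((if n = 0 then g x else 0)
      - bernoulliFun (n + 1) x • (g 1 - g 0) + bernoulliConv (n + 1) g' x) := by
  rw [bernoulliConv, bernoulliConv, integral_bernoulliFun_sub_smul n hg hg',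
    integral_bernoulliFun_sub_smul n hg hg', ← smul_add]
  congr 1
  have h1 := bernoulliFun_eval_one (n + 1)
  simp only [sub_zero, sub_self, add_sub_cancel_right, add_sub_cancel_left, h1, add_smul,
    Nat.add_eq_right, smul_sub]
  split_ifs <;> simp <;> abel

/-- The Euler–Maclaurin formula on one period, with the remainder as a convolution. -/
theorem eq_integral_add_sum_bernoulliFun (f : ℕ → ℝ → V)
    (hf : ∀ m s, HasDerivAt (f m) (f (m + 1) s) s) (x : ℝ) (n : ℕ) :
    f 0 x = (∫ s in (0 : ℝ)..1, f 0 s) +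
      ∑ l ∈ Finset.range (n + 1),
        (bernoulliFun (l + 1) x / (l + 1).factorial) • (f l 1 - f l 0) -
      (1 / (n + 1).factorial : ℝ) • bernoulliConv (n + 1) (f (n + 1)) x := by
  have hc : ∀ m, Continuous (f m) := fun m =>
    continuous_iff_continuousAt.2 fun s => (hf m s).continuousAt
  induction n with
  | zero =>
    have h := bernoulliConv_eq 0 (hf 0) (hc 1) x
    have h0 : bernoulliConv 0 (f 0) x = ∫ s in (0 : ℝ)..1, f 0 s := by
      simp only [bernoulliConv, bernoulliFun_zero, one_smul]
      exact intervalIntegral.integral_add_adjacent_intervals ((hc 0).intervalIntegrable _ _)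
        ((hc 0).intervalIntegrable _ _)
    rw [h0] at h
    rw [h]
    simp only [CharP.cast_eq_zero, zero_add, if_true, div_one, one_smul, Finset.range_one,
      Finset.sum_singleton, Nat.factorial_one, Nat.cast_one]
    abel
  | succ n ih =>
    rw [Finset.sum_range_succ]
    rw [bernoulliConv_eq (n + 1) (hf (n + 1)) (hc (n + 2)) x, smul_smul] at ih
    have hfac : (1 / (n + 1).factorial : ℝ) * (1 / (((n + 1 : ℕ) : ℝ) + 1)) =
        1 / (n + 2).factorial := by
      rw [Nat.factorial_succ (n + 1)]
      push_cast
      have : (((n + 1).factorial : ℕ) : ℝ) ≠ 0 := by positivity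
      field_simp
    rw [hfac] at ih
    rw [ih]
    rw [if_neg (Nat.succ_ne_zero n), zero_sub, smul_add, smul_neg, smul_smul, one_div_mul_eq_div]
    abel

/-- Euler–Maclaurin on one period, with a bound on the remainder. -/
theorem norm_sub_integral_sub_sum_bernoulliFun_le (f : ℕ → ℝ → V)
    (hf : ∀ m s, HasDerivAt (f m) (f (m + 1) s) s) {x M C : ℝ} (n : ℕ)
    (hx : x ∈ Set.Icc (0 : ℝ) 1)
    (hM : ∀ y ∈ Set.Icc (0 : ℝ) 1, |bernoulliFun (n + 1) y| ≤ M)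
    (hC : ∀ s ∈ Set.Icc (0 : ℝ) 1, ‖f (n + 1) s‖ ≤ C) :
    ‖f 0 x - (∫ s in (0 : ℝ)..1, f 0 s) -
      ∑ l ∈ Finset.range n, (bernoulliFun (l + 1) x / (l + 1).factorial) • (f l 1 - f l 0)‖ ≤
      2 * M / (n + 1).factorial * C := by
  have hM0 : 0 ≤ M := (abs_nonneg _).trans (hM x hx)
  -- The last Bernoulli term is absorbed into the remainder by the mean value inequality; this
  -- accounts for the factor 2 in the bound.
  have hd : ‖f n 1 - f n 0‖ ≤ C := by
    have := Convex.norm_image_sub_le_of_norm_hasDerivWithin_le (f := f n) (f' := f (n + 1))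
      (s := Set.Icc (0 : ℝ) 1) (C := C) (x := 0) (y := 1)
      (fun s _ => (hf n s).hasDerivWithinAt) hC (convex_Icc 0 1) (by simp) (by simp)
    simpa using this
  have hC0 : 0 ≤ C := (norm_nonneg _).trans hd
  have hEM := eq_integral_add_sum_bernoulliFun f hf x n
  rw [Finset.sum_range_succ] at hEM
  have hrw : f 0 x - (∫ s in (0 : ℝ)..1, f 0 s) -
      ∑ l ∈ Finset.range n, (bernoulliFun (l + 1) x / (l + 1).factorial) • (f l 1 - f l 0) =
      (bernoulliFun (n + 1) x / (n + 1).factorial) • (f n 1 - f n 0) -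
        (1 / (n + 1).factorial : ℝ) • bernoulliConv (n + 1) (f (n + 1)) x := by
    rw [hEM]; abel
  rw [hrw]
  refine (norm_sub_le _ _).trans ?_
  have hfac : (0 : ℝ) < (n + 1).factorial := by positivity
  have h1 : ‖(bernoulliFun (n + 1) x / (n + 1).factorial) • (f n 1 - f n 0)‖ ≤
      M / (n + 1).factorial * C := by
    rw [norm_smul, norm_div, Real.norm_eq_abs, Real.norm_natCast]
    gcongr
    exact hM x hx
  have h2 : ‖(1 / (n + 1).factorial : ℝ) • bernoulliConv (n + 1) (f (n + 1)) x‖ ≤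
      1 / (n + 1).factorial * (M * C) := by
    rw [norm_smul, norm_div, norm_one, Real.norm_natCast]
    gcongr
    exact norm_bernoulliConv_le hx hM hC
  calc _ ≤ M / (n + 1).factorial * C + 1 / (n + 1).factorial * (M * C) := add_le_add h1 h2
    _ = _ := by ring

/-- Euler–Maclaurin over `k` periods of length `h`, sampled at the points `(j + x) h`, for an orbit
of an isometric one-parameter group `φ` with generator `D`. -/
theorem norm_sum_orbit_sub_le (φ : ℝ → V →ₗ[ℝ] V) (D : Module.End ℝ V)
    (hzero : ∀ Y, φ 0 Y = Y) (hadd : ∀ s t Y, φ (s + t) Y = φ s (φ t Y))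
    (hder : ∀ Y s, HasDerivAt (fun s => φ s Y) (φ s (D Y)) s)
    (hnorm : ∀ s Y, ‖φ s Y‖ = ‖Y‖) (hcomm : ∀ s Y, D (φ s Y) = φ s (D Y))
    {x M h : ℝ} (hh : 0 ≤ h) (n : ℕ) (hx : x ∈ Set.Icc (0 : ℝ) 1)
    (hM : ∀ y ∈ Set.Icc (0 : ℝ) 1, |bernoulliFun (n + 1) y| ≤ M) (k : ℕ) (Z : V) :
    ‖h • ∑ j ∈ Finset.range k, φ ((j + x) * h) Z - (∫ s in (0 : ℝ)..k * h, φ s Z) -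
      ∑ l ∈ Finset.range n, (bernoulliFun (l + 1) x / (l + 1).factorial * h ^ (l + 1)) •
        (φ (k * h) ((D ^ l) Z) - (D ^ l) Z)‖ ≤
      k * h * (2 * M / (n + 1).factorial * (h ^ (n + 1) * ‖(D ^ (n + 1)) Z‖)) := by
  have hcpow : ∀ (l : ℕ) s Y, (D ^ l) (φ s Y) = φ s ((D ^ l) Y) := by
    intro l s Y
    induction l with
    | zero => simp
    | succ l ih => rw [pow_succ', Module.End.mul_apply, ih, hcomm, Module.End.mul_apply]
  have hcont : ∀ Y, Continuous fun s => φ s Y := fun Y =>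
    continuous_iff_continuousAt.2 fun s => (hder Y s).continuousAt
  -- a single period
  have hone : ∀ Y : V, ‖h • φ (x * h) Y - (∫ s in (0 : ℝ)..h, φ s Y) -
      ∑ l ∈ Finset.range n, (bernoulliFun (l + 1) x / (l + 1).factorial * h ^ (l + 1)) •
        (φ h ((D ^ l) Y) - (D ^ l) Y)‖ ≤
      h * (2 * M / (n + 1).factorial * (h ^ (n + 1) * ‖(D ^ (n + 1)) Y‖)) := by
    intro Y
    have key := norm_sub_integral_sub_sum_bernoulliFun_le
      (fun m s => h ^ m • φ (s * h) ((D ^ m) Y)) (fun m s => by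
        have h1 : HasDerivAt (fun s : ℝ => s * h) h s := by
          simpa using (hasDerivAt_id s).mul_const h
        have h2 := ((hder ((D ^ m) Y) (s * h)).scomp s h1).const_smul (h ^ m)
        rw [pow_succ' D, Module.End.mul_apply]
        simpa [pow_succ, mul_smul, Function.comp_def, Pi.smul_def] using h2) n hx hM
      (C := h ^ (n + 1) * ‖(D ^ (n + 1)) Y‖) (fun s _ => by
        rw [norm_smul, hnorm, Real.norm_of_nonneg (by positivity)])
    have hint : h • (∫ s in (0 : ℝ)..1, h ^ 0 • φ (s * h) ((D ^ 0) Y)) =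
        ∫ s in (0 : ℝ)..h, φ s Y := by
      have := intervalIntegral.smul_integral_comp_mul_right (a := 0) (b := 1) (fun s => φ s Y) h
      simpa using this
    have := mul_le_mul_of_nonneg_left key hh
    rw [← Real.norm_of_nonneg hh, ← norm_smul, Real.norm_of_nonneg hh] at this
    refine le_trans (le_of_eq ?_) this
    congr 1
    rw [smul_sub, smul_sub, hint, Finset.smul_sum]
    congr 1
    · simp
    · refine Finset.sum_congr rfl fun l _ => ?_
      rw [one_mul, zero_mul, hzero, ← smul_sub, smul_smul, smul_smul]
      congr 1
      ring
  induction k with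
  | zero => simp [hzero]
  | succ k ih =>
    have h1 := hone (φ (k * h) Z)
    simp only [hcpow, hnorm] at h1
    have hint : (∫ s in (0 : ℝ)..(k + 1 : ℕ) * h, φ s Z) =
        (∫ s in (0 : ℝ)..k * h, φ s Z) + ∫ s in (0 : ℝ)..h, φ s (φ (k * h) Z) := by
      rw [← intervalIntegral.integral_add_adjacent_intervals
        ((hcont Z).intervalIntegrable 0 (k * h)) ((hcont Z).intervalIntegrable _ _)]
      congr 1
      simp only [← hadd]
      rw [intervalIntegral.integral_comp_add_right (fun s => φ s Z)]
      congr 1 <;> push_cast <;> ring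
    -- The last period of `Z` is the first period of `φ (k * h) Z`, and the boundary terms
    -- telescope. Isometry and commutation with `D` make the error of every period the same.
    have hsplit : h • ∑ j ∈ Finset.range (k + 1), φ ((j + x) * h) Z -
        (∫ s in (0 : ℝ)..(k + 1 : ℕ) * h, φ s Z) -
        ∑ l ∈ Finset.range n, (bernoulliFun (l + 1) x / (l + 1).factorial * h ^ (l + 1)) •
          (φ ((k + 1 : ℕ) * h) ((D ^ l) Z) - (D ^ l) Z) =
        (h • ∑ j ∈ Finset.range k, φ ((j + x) * h) Z - (∫ s in (0 : ℝ)..k * h, φ s Z) -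
        ∑ l ∈ Finset.range n, (bernoulliFun (l + 1) x / (l + 1).factorial * h ^ (l + 1)) •
          (φ (k * h) ((D ^ l) Z) - (D ^ l) Z)) +
        (h • φ (x * h) (φ (k * h) Z) - (∫ s in (0 : ℝ)..h, φ s (φ (k * h) Z)) -
        ∑ l ∈ Finset.range n, (bernoulliFun (l + 1) x / (l + 1).factorial * h ^ (l + 1)) •
          (φ h (φ (k * h) ((D ^ l) Z)) - φ (k * h) ((D ^ l) Z))) := by
      rw [Finset.sum_range_succ, hint, smul_add]
      have e1 : φ ((k + x) * h) Z = φ (x * h) (φ (k * h) Z) := by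
        rw [← hadd]; congr 2; ring
      have e2 : ∀ Y, φ ((k + 1 : ℕ) * h) Y = φ h (φ (k * h) Y) := by
        intro Y; rw [← hadd]; congr 2; push_cast; ring
      rw [e1]
      simp only [e2]
      have e3 : ∑ l ∈ Finset.range n, (bernoulliFun (l + 1) x / (l + 1).factorial * h ^ (l + 1)) •
          (φ h (φ (k * h) ((D ^ l) Z)) - (D ^ l) Z) =
          ∑ l ∈ Finset.range n, (bernoulliFun (l + 1) x / (l + 1).factorial * h ^ (l + 1)) •
            (φ (k * h) ((D ^ l) Z) - (D ^ l) Z) +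
          ∑ l ∈ Finset.range n, (bernoulliFun (l + 1) x / (l + 1).factorial * h ^ (l + 1)) •
            (φ h (φ (k * h) ((D ^ l) Z)) - φ (k * h) ((D ^ l) Z)) := by
        rw [← Finset.sum_add_distrib]
        refine Finset.sum_congr rfl fun l _ => ?_
        rw [← smul_add]
        congr 1
        abel
      rw [e3]
      abel
    rw [hsplit]
    refine (norm_add_le _ _).trans ((add_le_add ih h1).trans (le_of_eq ?_))
    push_cast
    ring

end Jets

/-! ### Bounds for Bernoulli polynomials on the unit interval -/

section Bernoulli

open Complex

theorem norm_fourier_unitAddCircle (n : ℤ) (x : UnitAddCircle) : ‖fourier n x‖ = 1 := by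
  rw [fourier_apply]; exact Circle.norm_coe _

/-- Triangle inequality in the Fourier series of `B_n`: the modes `m` and `-m` together contribute
at most `2/m^n`. -/
theorem abs_bernoulliFun_mul_le_tsum {n : ℕ} (hn : 2 ≤ n) {x : ℝ} (hx : x ∈ Set.Icc (0 : ℝ) 1) :
    (2 * Real.pi) ^ n / n.factorial * |bernoulliFun n x| ≤ ∑' m : ℕ, 2 * (1 / (m : ℝ) ^ n) := by
  have hs := hasSum_one_div_nat_pow_mul_fourier hn hx
  have hsum : Summable fun m : ℕ => 2 * (1 / (m : ℝ) ^ n) :=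
    (Real.summable_one_div_nat_pow.2 (by omega)).mul_left 2
  have hle := tsum_of_norm_bounded hsum.hasSum (fun m : ℕ => ?_) (f := fun m : ℕ =>
    1 / (m : ℂ) ^ n * (fourier (m : ℤ) (x : UnitAddCircle) +
      (-1) ^ n * fourier (-(m : ℤ)) (x : UnitAddCircle)))
  · rw [hs.tsum_eq] at hle
    refine le_trans (le_of_eq ?_) hle
    rw [norm_mul, norm_div, norm_neg, norm_pow, norm_mul, norm_mul, Complex.norm_I,
      Complex.norm_real, Complex.norm_real, Complex.norm_natCast, Real.norm_of_nonneg Real.pi_nonneg]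
    simp
  · rw [norm_mul, norm_div, norm_one, norm_pow, Complex.norm_natCast, mul_comm]
    refine mul_le_mul_of_nonneg_right ((norm_add_le _ _).trans ?_) (by positivity)
    rw [norm_mul, norm_pow, norm_neg, norm_one, one_pow, one_mul, norm_fourier_unitAddCircle,
      norm_fourier_unitAddCircle]
    norm_num

/-- For even `n ≥ 2`, `|B_n(x)|` is largest at the end points of `[0, 1]`. -/
theorem abs_bernoulliFun_le_of_even {n : ℕ} (hn : 2 ≤ n) (he : Even n) {x : ℝ}
    (hx : x ∈ Set.Icc (0 : ℝ) 1) : |bernoulliFun n x| ≤ |((bernoulli n : ℚ) : ℝ)| := by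
  have h1 := abs_bernoulliFun_mul_le_tsum hn hx
  have h0 := hasSum_one_div_nat_pow_mul_fourier hn (x := 0) (by simp)
  have hsum : HasSum (fun m : ℕ => ((2 * (1 / (m : ℝ) ^ n) : ℝ) : ℂ))
      (((∑' m : ℕ, 2 * (1 / (m : ℝ) ^ n) : ℝ)) : ℂ) := by
    exact_mod_cast ((Real.summable_one_div_nat_pow.2 (by omega)).mul_left 2).hasSum
  -- At `x = 0` with `n` even the two modes add with equal sign, so the triangle inequality is an
  -- equality there.
  have heq := h0.unique (by
    convert hsum using 2 with m
    simp [he.neg_one_pow]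
    ring)
  have hnorm := congrArg norm heq
  rw [norm_mul, norm_div, norm_neg, norm_pow, norm_mul, norm_mul, Complex.norm_I,
    Complex.norm_real, Complex.norm_real, Complex.norm_natCast, Real.norm_of_nonneg Real.pi_nonneg,
    Complex.norm_real, bernoulliFun_eval_zero, Real.norm_eq_abs, Real.norm_eq_abs,
    abs_of_nonneg (a := ∑' m : ℕ, 2 * (1 / (m : ℝ) ^ n)) (tsum_nonneg fun m => by positivity)]
    at hnorm
  rw [← hnorm] at h1
  simp only [Complex.norm_ofNat, mul_one] at h1
  exact le_of_mul_le_mul_left h1 (by positivity)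

/-- The factor `n + 1` is deliberately generous: integrating `x^n` over `[0,1]` later supplies a
compensating `1/(n+1)`. It also covers `n = 1`, where the Fourier series is not absolutely
convergent. -/
theorem abs_bernoulliFun_div_factorial_le {n : ℕ} (hn : 1 ≤ n) {x : ℝ}
    (hx : x ∈ Set.Icc (0 : ℝ) 1) :
    |bernoulliFun n x| ≤ n.factorial * (2 * (n + 1) / (2 * Real.pi) ^ n) := by
  have hpi := Real.pi_pos
  rcases Nat.lt_or_ge n 2 with h | h
  · obtain rfl : n = 1 := by omega
    simp only [bernoulliFun_one, Nat.factorial_one, pow_one, Nat.cast_one]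
    have h1 : |x - 1 / 2| ≤ 1 / 2 := abs_le.2 ⟨by linarith [hx.1], by linarith [hx.2]⟩
    refine h1.trans ?_
    rw [one_mul, div_le_div_iff₀ (by norm_num) (by positivity)]
    linarith [Real.pi_lt_four]
  · have h1 := abs_bernoulliFun_mul_le_tsum h hx
    have h2 : ∑' m : ℕ, 2 * (1 / (m : ℝ) ^ n) ≤ 2 * (n + 1) := by
      rw [tsum_mul_left]
      have : ∑' m : ℕ, 1 / (m : ℝ) ^ n ≤ ∑' m : ℕ, 1 / (m : ℝ) ^ 2 := by
        refine Summable.tsum_le_tsum (fun m => ?_) (Real.summable_one_div_nat_pow.2 (by omega))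
          (Real.summable_one_div_nat_pow.2 (by omega))
        -- The index `m = 0` contributes `1/0 = 0` on both sides.
        rcases Nat.eq_zero_or_pos m with rfl | hm
        · simp [show n ≠ 0 by omega]
        · have hm' : (1 : ℝ) ≤ m := by exact_mod_cast hm
          exact one_div_le_one_div_of_le (by positivity) (pow_le_pow_right₀ hm' h)
      rw [hasSum_zeta_two.tsum_eq] at this
      have hn' : (2 : ℝ) ≤ n := by exact_mod_cast h
      have hp4 : Real.pi ^ 2 / 6 ≤ 3 := by nlinarith [Real.pi_lt_four]
      linarith
    have h3 := h1.trans h2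
    rw [div_mul_eq_mul_div, div_le_iff₀ (by positivity)] at h3
    rw [← mul_div_assoc, le_div_iff₀ (by positivity)]
    linarith

theorem abs_bernoulliFun_le_bernoulliMax (n : ℕ) {x : ℝ} (hx : x ∈ Set.Icc (0 : ℝ) 1) :
    |bernoulliFun n x| ≤ bernoulliMax n := by
  refine le_ciSup (f := fun x : Set.Icc (0 : ℝ) 1 => |bernoulliFun n x|) ?_ ⟨x, hx⟩
  have := (isCompact_Icc (a := (0 : ℝ)) (b := 1)).bddAbove_image
    (f := fun x => |bernoulliFun n x|) (by fun_prop)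
  refine this.mono ?_
  rintro _ ⟨y, rfl⟩
  exact ⟨y, y.2, rfl⟩

end Bernoulli

/-! ### Trace norm duality -/

section TraceNorm

variable {E : Type*} [NormedAddCommGroup E] [InnerProductSpace ℂ E] [FiniteDimensional ℂ E]

/-- The trace norm is attained on a contraction (the adjoint of the polar part of `X`). -/
theorem exists_traceNorm_eq_trace (X : E →L[ℂ] E) :
    ∃ W : E →L[ℂ] E, ‖W‖ ≤ 1 ∧
      LinearMap.trace ℂ E ((W * X : E →L[ℂ] E) : E →ₗ[ℂ] E) = (traceNorm X : ℂ) := by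
  set T : E →ₗ[ℂ] E := (X : E →ₗ[ℂ] E)
  have hS := T.isSymmetric_adjoint_comp_self
  set v := hS.eigenvectorBasis rfl
  set σ : Fin (Module.finrank ℂ E) → ℝ := fun i => T.singularValues i
  have hinner : ∀ i j, inner ℂ (T (v i)) (T (v j)) = if i = j then ((σ i : ℂ)) ^ 2 else 0 := by
    intro i j
    rw [← LinearMap.adjoint_inner_right, ← LinearMap.comp_apply, hS.apply_eigenvectorBasis,
      inner_smul_right, orthonormal_iff_ite.1 v.orthonormal i j]
    split_ifs with h
    · subst h
      rw [← T.sq_singularValues_fin rfl i]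
      simp [σ]
    · simp
  -- The left singular vectors; `u i = 0` when `σ i = 0`, because `0⁻¹ = 0`. The contraction `W`
  -- sends `u i` to `v i` wherever `σ i ≠ 0`.
  set u : Fin (Module.finrank ℂ E) → E := fun i => ((σ i : ℂ))⁻¹ • T (v i)
  have hu : Orthonormal ℂ fun i : {i // σ i ≠ 0} => u i := by
    rw [orthonormal_iff_ite]
    rintro ⟨i, hi⟩ ⟨j, hj⟩
    have hi' : (σ i : ℂ) ≠ 0 := by exact_mod_cast hi
    simp only [u, inner_smul_left, inner_smul_right, hinner, Subtype.mk.injEq, map_inv₀,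
      Complex.conj_ofReal]
    split_ifs with h
    · subst h
      field_simp
    · simp
  set W : E →L[ℂ] E := ∑ i, (innerSL ℂ (u i)).smulRight (v i)
  have hW : ∀ y, W y = ∑ i, inner ℂ (u i) y • v i := by
    intro y; simp [W]
  have hWv : ∀ i, (W * X) (v i) = (σ i : ℂ) • v i := by
    intro i
    change W (T (v i)) = _
    rw [hW, Finset.sum_eq_single i]
    · simp only [u, inner_smul_left, hinner, if_true, map_inv₀, Complex.conj_ofReal]
      congr 1
      rcases eq_or_ne (σ i : ℂ) 0 with h | h
      · simp [h]
      · field_simp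
    · intro j _ hj
      simp [u, hinner, hj]
    · simp
  refine ⟨W, ?_, ?_⟩
  · refine ContinuousLinearMap.opNorm_le_bound _ zero_le_one fun y => ?_
    rw [one_mul, ← abs_of_nonneg (norm_nonneg (W y)), ← abs_of_nonneg (norm_nonneg y), ← sq_le_sq]
    have h1 : ‖W y‖ ^ 2 = ∑ i, ‖inner ℂ (u i) y‖ ^ 2 := by
      rw [← v.sum_sq_norm_inner_right (W y)]
      refine Finset.sum_congr rfl fun i _ => ?_
      rw [hW, inner_sum, Finset.sum_eq_single i]
      · rw [inner_smul_right, orthonormal_iff_ite.1 v.orthonormal i i]; simp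
      · intro j _ hj
        rw [inner_smul_right, orthonormal_iff_ite.1 v.orthonormal i j]; simp [hj.symm]
      · simp
    -- Only the nonzero `u i` are orthonormal, so Bessel's inequality is applied to those.
    have h2 : ∑ i, ‖inner ℂ (u i) y‖ ^ 2 = ∑ i : {i // σ i ≠ 0}, ‖inner ℂ (u i) y‖ ^ 2 := by
      rw [← Finset.sum_filter_of_ne (p := fun i => σ i ≠ 0)]
      · exact Finset.sum_subtype _ (by simp) _
      · intro i _ hi h
        simp [u, h] at hi
    rw [h1, h2]
    exact hu.sum_inner_products_le y
  · rw [LinearMap.trace_eq_sum_inner _ v]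
    have : ∀ i, inner ℂ (v i) (((W * X : E →L[ℂ] E) : E →ₗ[ℂ] E) (v i)) = (σ i : ℂ) := by
      intro i
      rw [ContinuousLinearMap.coe_coe, hWv, inner_smul_right,
        orthonormal_iff_ite.1 v.orthonormal i i]
      simp
    simp only [this]
    rw [traceNorm, Finset.sum_range, Complex.ofReal_sum]

/-- In an eigenbasis of `ρ` the trace is an average of the diagonal entries of `A`, weighted by the
eigenvalues, which are nonnegative and sum to one. -/
theorem norm_trace_mul_density_le {ρ : E →L[ℂ] E} (hρ : IsDensity ρ) (A : E →L[ℂ] E) :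
    ‖LinearMap.trace ℂ E ((A * ρ : E →L[ℂ] E) : E →ₗ[ℂ] E)‖ ≤ ‖A‖ := by
  obtain ⟨hpos, htr⟩ := hρ
  have hpos' : (ρ : E →ₗ[ℂ] E).IsPositive := hpos.toLinearMap
  have hS := hpos'.isSymmetric
  set v := hS.eigenvectorBasis rfl
  set lam := hS.eigenvalues rfl
  have hlam : ∀ i, 0 ≤ lam i := hpos'.nonneg_eigenvalues rfl
  have hv : ∀ i, ρ (v i) = (lam i : ℂ) • v i := fun i => hS.apply_eigenvectorBasis rfl i
  have hsum : ∑ i, lam i = 1 := by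
    rw [LinearMap.trace_eq_sum_inner _ v] at htr
    have : ∀ i, inner ℂ (v i) ((ρ : E →ₗ[ℂ] E) (v i)) = (lam i : ℂ) := by
      intro i
      rw [ContinuousLinearMap.coe_coe, hv, inner_smul_right,
        orthonormal_iff_ite.1 v.orthonormal i i]
      simp
    simp only [this] at htr
    exact_mod_cast htr
  rw [LinearMap.trace_eq_sum_inner _ v]
  calc _ ≤ ∑ i, lam i * ‖A‖ := by
        refine norm_sum_le_of_le _ fun i _ => ?_
        change ‖inner ℂ (v i) (A (ρ (v i)))‖ ≤ _
        rw [hv, map_smul, inner_smul_right, norm_mul, Complex.norm_real,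
          Real.norm_of_nonneg (hlam i)]
        refine mul_le_mul_of_nonneg_left ?_ (hlam i)
        refine (norm_inner_le_norm _ _).trans ?_
        have := A.le_opNorm (v i)
        simpa [v.orthonormal.1 i] using this
    _ = ‖A‖ := by rw [← Finset.sum_mul, hsum, one_mul]

/-- Bounds in trace norm, by duality with the operator norm. -/
theorem traceNorm_le_of_forall {X : E →L[ℂ] E} {K : ℝ}
    (h : ∀ W : E →L[ℂ] E, ‖W‖ ≤ 1 →
      ‖LinearMap.trace ℂ E ((W * X : E →L[ℂ] E) : E →ₗ[ℂ] E)‖ ≤ K) : traceNorm X ≤ K := by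
  obtain ⟨W, hW, htr⟩ := exists_traceNorm_eq_trace X
  have := h W hW
  rw [htr, Complex.norm_real] at this
  exact (le_abs_self _).trans this

end TraceNorm

/-! ### Ordered products with one factor singled out -/

section ReverseProduct

variable {M : Type*} [Monoid M]

/-- The product `w (d - 1) * ⋯ * w 1 * w 0`. -/
def revProd {d : ℕ} (w : Fin d → M) : M := (List.ofFn fun j : Fin d => w j.rev).prod

theorem revProd_succ {d : ℕ} (w : Fin (d + 1) → M) :
    revProd w = w (Fin.last d) * revProd fun j => w j.castSucc := by
  simp [revProd, List.ofFn_succ, Fin.rev_succ]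

theorem revProd_one {d : ℕ} (w : Fin d → M) (h : ∀ j, w j = 1) : revProd w = 1 := by
  simp [revProd, h]

/-- With trivial factors above `a`, the factor at `a` is effectively the leftmost one. The result
serves ordered exponentials and nested commutators alike. -/
theorem revProd_eq_mul_update {d : ℕ} (w : Fin d → M) (a : Fin d) (h : ∀ j, a < j → w j = 1) :
    revProd w = w a * revProd (Function.update w a 1) := by
  induction d with
  | zero => exact a.elim0
  | succ d ih =>
    rw [revProd_succ, revProd_succ (Function.update w a 1)]
    induction a using Fin.lastCases with
    | last =>
      have : ∀ j : Fin d, j.castSucc ≠ Fin.last d := fun j => (Fin.castSucc_lt_last j).ne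
      simp [Function.update_of_ne, this]
    | cast a =>
      have h1 : w (Fin.last d) = 1 := h _ (Fin.castSucc_lt_last a)
      rw [Function.update_of_ne (Fin.castSucc_lt_last a).ne', h1, one_mul, one_mul,
        ih (fun j => w j.castSucc) a fun j hj => h _ (Fin.castSucc_lt_castSucc_iff.2 hj)]
      congr 2
      funext j
      simp [Function.update_apply]

theorem revProd_eq_update_mul {d : ℕ} (w : Fin d → M) (a : Fin d) (h : ∀ j, j < a → w j = 1) :
    revProd w = revProd (Function.update w a 1) * w a := by
  induction d with
  | zero => exact a.elim0
  | succ d ih =>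
    rw [revProd_succ, revProd_succ (Function.update w a 1)]
    induction a using Fin.lastCases with
    | last =>
      have h1 : ∀ j : Fin d, j.castSucc ≠ Fin.last d := fun j => (Fin.castSucc_lt_last j).ne
      have h2 : ∀ j : Fin d, w j.castSucc = 1 := fun j => h _ (Fin.castSucc_lt_last j)
      simp [Function.update_of_ne, h1, revProd_one _ h2]
    | cast a =>
      rw [Function.update_of_ne (Fin.castSucc_lt_last a).ne',
        ih (fun j => w j.castSucc) a fun j hj => h _ (Fin.castSucc_lt_castSucc_iff.2 hj), mul_assoc]
      congr 3
      funext j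
      simp [Function.update_apply]

end ReverseProduct

/-! ### One-parameter groups, conjugation, and the generator of the product formula -/

section Evolution

variable {E : Type*} [NormedAddCommGroup E] [InnerProductSpace ℂ E]

/-- Conjugation by `U` as a linear map. -/
noncomputable def conjLin (U : E →L[ℂ] E) : Module.End ℂ (E →L[ℂ] E) :=
  LinearMap.mulLeft ℂ U ∘ₗ LinearMap.mulRight ℂ (Ring.inverse U)

theorem conjLin_apply (U X : E →L[ℂ] E) : conjLin U X = conj U X := by
  simp [conjLin, conj, mul_assoc]

theorem Ad_apply (X Y : E →L[ℂ] E) : Ad X Y = X * Y - Y * X := by simp [Ad]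

theorem conj_one (X : E →L[ℂ] E) : conj 1 X = X := by simp [conj]

theorem conj_mul {U V : E →L[ℂ] E} (hU : IsUnit U) (hV : IsUnit V) (X : E →L[ℂ] E) :
    conj (U * V) X = conj U (conj V X) := by
  obtain ⟨u, rfl⟩ := hU
  obtain ⟨v, rfl⟩ := hV
  rw [conj, conj, conj, ← Units.val_mul, Ring.inverse_unit, Ring.inverse_unit, Ring.inverse_unit,
    mul_inv_rev]
  simp [mul_assoc]

theorem evol_zero (X : E →L[ℂ] E) : evol X 0 = 1 := by simp [evol]

variable {d : ℕ}

theorem orderedExp_eq_revProd (F : Fin d → E →L[ℂ] E) (τ : Fin d → ℝ) :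
    orderedExp F τ = revProd fun j => evol (F j) (τ j) := rfl

theorem nestedComm_eq_revProd (F : Fin d → E →L[ℂ] E) (q : Fin d → ℕ) (B : E →L[ℂ] E) :
    nestedComm F q B = revProd (fun j => Ad (F j) ^ q j) B := rfl

theorem orderedExp_of_eq_zero (F : Fin d → E →L[ℂ] E) {τ : Fin d → ℝ} (h : ∀ j, τ j = 0) :
    orderedExp F τ = 1 := by
  rw [orderedExp_eq_revProd]
  exact revProd_one _ fun j => by rw [h, evol_zero]

theorem orderedExp_succ (F : Fin (d + 1) → E →L[ℂ] E) (τ : Fin (d + 1) → ℝ) :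
    orderedExp F τ = evol (F (Fin.last d)) (τ (Fin.last d)) *
      orderedExp (fun j => F j.castSucc) fun j => τ j.castSucc :=
  revProd_succ fun j => evol (F j) (τ j)

theorem evol_update (F : Fin d → E →L[ℂ] E) (τ : Fin d → ℝ) (a : Fin d) :
    Function.update (fun j => evol (F j) (τ j)) a 1 =
      fun j => evol (F j) (Function.update τ a 0 j) := by
  funext j
  rcases eq_or_ne j a with rfl | h
  · simp [evol_zero]
  · simp [h]

theorem orderedExp_eq_evol_mul (F : Fin d → E →L[ℂ] E) (τ : Fin d → ℝ) (a : Fin d)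
    (h : ∀ j, a < j → τ j = 0) :
    orderedExp F τ = evol (F a) (τ a) * orderedExp F (Function.update τ a 0) := by
  have := revProd_eq_mul_update (fun j => evol (F j) (τ j)) a fun j hj => by rw [h j hj, evol_zero]
  rw [evol_update] at this
  exact this

/-- Read backwards, this merges one more exponential on the right into an ordered exponential; that
is how conjugations accumulate to elements of `Γ(t)`. -/
theorem orderedExp_eq_mul_evol (F : Fin d → E →L[ℂ] E) (τ : Fin d → ℝ) (a : Fin d)
    (h : ∀ j, j < a → τ j = 0) :
    orderedExp F τ = orderedExp F (Function.update τ a 0) * evol (F a) (τ a) := by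
  have := revProd_eq_update_mul (fun j => evol (F j) (τ j)) a fun j hj => by rw [h j hj, evol_zero]
  rw [evol_update] at this
  exact this

theorem nestedComm_update (F : Fin d → E →L[ℂ] E) (q : Fin d → ℕ) (a : Fin d) (r : ℕ)
    (h : ∀ j, a ≤ j → q j = 0) (B : E →L[ℂ] E) :
    nestedComm F (Function.update q a r) B = (Ad (F a) ^ r) (nestedComm F q B) := by
  have h1 := revProd_eq_mul_update (fun j => Ad (F j) ^ Function.update q a r j) a fun j hj => by
    rw [Function.update_of_ne hj.ne', h j hj.le, pow_zero]
  have h2 : Function.update (fun j => Ad (F j) ^ Function.update q a r j) a 1 =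
      fun j => Ad (F j) ^ q j := by
    funext j
    rcases eq_or_ne j a with rfl | hj
    · simp [h j le_rfl]
    · simp [hj]
  rw [h2, Function.update_self] at h1
  exact congrArg (fun f => f B) h1

theorem nestedComm_zero (F : Fin d → E →L[ℂ] E) (B : E →L[ℂ] E) : nestedComm F 0 B = B := by
  rw [nestedComm_eq_revProd, revProd_one (fun j => Ad (F j) ^ (0 : Fin d → ℕ) j) fun j => pow_zero _,
    Module.End.one_apply]

variable [CompleteSpace E]

theorem evol_add (X : E →L[ℂ] E) (s t : ℝ) : evol X (s + t) = evol X s * evol X t := by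
  let _ := NormedAlgebra.restrictScalars ℚ ℂ (E →L[ℂ] E)
  rw [evol, evol, evol, ← NormedSpace.exp_add_of_commute
    (((Commute.refl X).smul_left _).smul_right _), ← add_smul]
  congr 2
  push_cast
  ring

theorem evol_mul_evol_neg (X : E →L[ℂ] E) (s : ℝ) : evol X s * evol X (-s) = 1 := by
  rw [← evol_add, add_neg_cancel, evol_zero]

theorem evol_neg_mul_evol (X : E →L[ℂ] E) (s : ℝ) : evol X (-s) * evol X s = 1 := by
  rw [← evol_add, neg_add_cancel, evol_zero]

theorem isUnit_evol (X : E →L[ℂ] E) (s : ℝ) : IsUnit (evol X s) :=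
  ⟨⟨_, _, evol_mul_evol_neg X s, evol_neg_mul_evol X s⟩, rfl⟩

theorem inverse_evol (X : E →L[ℂ] E) (s : ℝ) : Ring.inverse (evol X s) = evol X (-s) :=
  Ring.inverse_unit ⟨_, _, evol_mul_evol_neg X s, evol_neg_mul_evol X s⟩

theorem conj_evol (X Y : E →L[ℂ] E) (s : ℝ) :
    conj (evol X s) Y = evol X s * Y * evol X (-s) := by
  rw [conj, inverse_evol]

theorem hasDerivAt_evol (X : E →L[ℂ] E) (s : ℝ) :
    HasDerivAt (evol X) ((-Complex.I) • (X * evol X s)) s := by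
  have h := hasDerivAt_exp_smul_const' ((-Complex.I) • X) s
  have hfun : evol X = fun u : ℝ => NormedSpace.exp (u • (-Complex.I) • X) := by
    funext u
    rw [evol]
    congr 1
    rw [← smul_assoc, Complex.real_smul]
    congr 1
    ring
  rw [hfun]
  simpa using h

theorem commute_evol (X : E →L[ℂ] E) (s : ℝ) : Commute X (evol X s) := by
  let _ := NormedAlgebra.restrictScalars ℚ ℂ (E →L[ℂ] E)
  exact ((Commute.refl X).smul_right _).exp_right

theorem hasDerivAt_conj_evol (X Y : E →L[ℂ] E) (s : ℝ) :
    HasDerivAt (fun s => conj (evol X s) Y) (conj (evol X s) ((-Complex.I) • Ad X Y)) s := by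
  have h1 := hasDerivAt_evol X s
  have h2 : HasDerivAt (fun s => evol X (-s)) (Complex.I • (X * evol X (-s))) s := by
    have := (hasDerivAt_evol X (-s)).scomp s (hasDerivAt_neg s)
    simpa [Function.comp_def] using this
  have h3 := (h1.mul_const Y).mul h2
  have hfun : (fun s => conj (evol X s) Y) = fun s => evol X s * Y * evol X (-s) :=
    funext fun s => conj_evol X Y s
  rw [hfun]
  refine h3.congr_deriv ?_
  rw [conj_evol, Ad_apply, (commute_evol X s).eq]
  simp only [neg_smul, neg_mul, mul_neg, smul_mul_assoc, mul_smul_comm, mul_sub, sub_mul, smul_sub,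
    mul_assoc]
  abel

theorem Ad_conj_evol (X Y : E →L[ℂ] E) (s : ℝ) :
    Ad X (conj (evol X s) Y) = conj (evol X s) (Ad X Y) := by
  rw [conj_evol, conj_evol, Ad_apply, Ad_apply, mul_sub, sub_mul]
  congr 1
  · rw [← mul_assoc, ← mul_assoc, ← mul_assoc, (commute_evol X s).eq]
  · rw [mul_assoc _ _ X, mul_assoc, ← (commute_evol X (-s)).eq]
    simp only [mul_assoc]

theorem evol_mem_unitary {X : E →L[ℂ] E} (hX : IsSelfAdjoint X) (s : ℝ) :
    evol X s ∈ unitary (E →L[ℂ] E) := by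
  let _ := NormedAlgebra.restrictScalars ℚ ℂ (E →L[ℂ] E)
  refine NormedSpace.exp_mem_unitary_of_mem_skewAdjoint (hX.smul_mem_skewAdjoint ?_)
  rw [skewAdjoint.mem_iff]
  simp

theorem inverse_of_mem_unitary {U : E →L[ℂ] E} (hU : U ∈ unitary (E →L[ℂ] E)) :
    Ring.inverse U = star U :=
  Ring.inverse_unit ⟨U, star U, Unitary.mul_star_self_of_mem hU, Unitary.star_mul_self_of_mem hU⟩

theorem isUnit_of_mem_unitary {U : E →L[ℂ] E} (hU : U ∈ unitary (E →L[ℂ] E)) : IsUnit U :=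
  ⟨⟨U, star U, Unitary.mul_star_self_of_mem hU, Unitary.star_mul_self_of_mem hU⟩, rfl⟩

theorem conj_of_mem_unitary {U : E →L[ℂ] E} (hU : U ∈ unitary (E →L[ℂ] E)) (X : E →L[ℂ] E) :
    conj U X = U * X * star U := by
  rw [conj, inverse_of_mem_unitary hU]

theorem norm_conj {U : E →L[ℂ] E} (hU : U ∈ unitary (E →L[ℂ] E)) (X : E →L[ℂ] E) :
    ‖conj U X‖ = ‖X‖ := by
  rw [conj_of_mem_unitary hU, CStarRing.norm_mul_mem_unitary _ (Unitary.star_mem hU),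
    CStarRing.norm_mem_unitary_mul _ hU]

theorem revProd_mem_unitary {w : Fin d → E →L[ℂ] E} (hw : ∀ j, w j ∈ unitary (E →L[ℂ] E)) :
    revProd w ∈ unitary (E →L[ℂ] E) := by
  refine list_prod_mem fun x hx => ?_
  obtain ⟨j, rfl⟩ := List.mem_ofFn.1 hx
  exact hw _

theorem orderedExp_mem_unitary {F : Fin d → E →L[ℂ] E} (hF : ∀ a, IsSelfAdjoint (F a))
    (τ : Fin d → ℝ) : orderedExp F τ ∈ unitary (E →L[ℂ] E) := by
  rw [orderedExp_eq_revProd]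
  exact revProd_mem_unitary fun j => evol_mem_unitary (hF j) (τ j)

/-- The generator of the product formula: `S'(s) = -i (effHam F s) S(s)`. -/
noncomputable def effHam (F : Fin d → E →L[ℂ] E) (s : ℝ) : E →L[ℂ] E :=
  ∑ b, conj (orderedExp F fun j => if j ∈ Finset.Ioi b then s else 0) (F b)

theorem effHam_succ {F : Fin (d + 1) → E →L[ℂ] E} (hF : ∀ a, IsSelfAdjoint (F a)) (s : ℝ) :
    effHam F s = F (Fin.last d) +
      conj (evol (F (Fin.last d)) s) (effHam (fun j => F j.castSucc) s) := by
  rw [effHam, Fin.sum_univ_castSucc, add_comm, effHam, ← conjLin_apply (evol _ _), map_sum]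
  congr 1
  · rw [orderedExp_of_eq_zero, conj_one]
    intro j
    simp [Fin.le_last j]
  · refine Finset.sum_congr rfl fun b _ => ?_
    rw [orderedExp_succ, conj_mul (isUnit_evol _ _)
      (isUnit_of_mem_unitary (orderedExp_mem_unitary (fun a => hF _) _)), conjLin_apply]
    simp [Fin.castSucc_lt_last]

/-- Product rule, by induction on `d`: the generator of the inner product is pulled to the left
through the outermost exponential, which conjugates it as in `effHam_succ`. -/
theorem hasDerivAt_prodFormula {F : Fin d → E →L[ℂ] E} (hF : ∀ a, IsSelfAdjoint (F a)) (s : ℝ) :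
    HasDerivAt (prodFormula F) ((-Complex.I) • (effHam F s * prodFormula F s)) s := by
  induction d with
  | zero =>
    have : prodFormula F = fun _ => 1 := by funext s; simp [prodFormula, orderedExp]
    rw [this]
    simpa [effHam] using hasDerivAt_const s (1 : E →L[ℂ] E)
  | succ d ih =>
    have h1 := (hasDerivAt_evol (F (Fin.last d)) s).mul (ih fun a => hF a.castSucc)
    have hfun : prodFormula F = fun s => evol (F (Fin.last d)) s *
        prodFormula (fun j => F j.castSucc) s := funext fun s => orderedExp_succ F _
    rw [hfun]
    refine h1.congr_deriv ?_
    rw [effHam_succ hF, conj_evol]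
    have h2 := evol_neg_mul_evol (F (Fin.last d)) s
    simp only [add_mul, mul_assoc, smul_mul_assoc, mul_smul_comm, smul_add]
    rw [← mul_assoc (evol _ (-s)), h2, one_mul]

end Evolution

/-! ### Multinomial sums and Taylor expansion of iterated conjugations -/

theorem sum_piAntidiag_insert {ι G : Type*} [DecidableEq ι] [AddCommMonoid G] {a : ι}
    {T : Finset ι} (ha : a ∉ T) (n : ℕ) (f : (ι → ℕ) → G) :
    ∑ q ∈ Finset.piAntidiag (insert a T) n, f q =
      ∑ m ∈ Finset.range (n + 1), ∑ q ∈ Finset.piAntidiag T m,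
        f (Function.update q a (n - m)) := by
  rw [← Finset.cons_eq_insert a T ha, Finset.piAntidiag_cons ha, Finset.sum_disjiUnion,
    ← Finset.Nat.sum_antidiagonal_swap, Finset.Nat.sum_antidiagonal_eq_sum_range_succ_mk]
  refine Finset.sum_congr rfl fun m _ => ?_
  rw [Finset.sum_map]
  refine Finset.sum_congr rfl fun q hq => ?_
  congr 1
  have hqa : q a = 0 := by
    by_contra h
    exact ha ((Finset.mem_piAntidiag.1 hq).2 a h)
  funext j
  rcases eq_or_ne j a with rfl | hj
  · simp [hqa]
  · simp [hj]

theorem multinomial_insert_update {ι : Type*} [DecidableEq ι] {a : ι} {T : Finset ι} (ha : a ∉ T)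
    {m : ℕ} {q : ι → ℕ} (hq : q ∈ Finset.piAntidiag T m) {n : ℕ} (hm : m ≤ n) :
    Nat.multinomial (insert a T) (Function.update q a (n - m)) =
      n.choose m * Nat.multinomial T q := by
  have hne : ∀ i ∈ T, Function.update q a (n - m) i = q i := fun i hi =>
    Function.update_of_ne (ne_of_mem_of_not_mem hi ha) _ _
  rw [Nat.multinomial_insert ha, Function.update_self, Finset.sum_congr rfl hne,
    Nat.multinomial_congr hne]
  have hs : T.sum q = m := (Finset.mem_piAntidiag.1 hq).1
  rw [show ∑ i ∈ T, q i = m from hs, Nat.sub_add_cancel hm, Nat.choose_symm hm]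

section Taylor

variable {E : Type*} [NormedAddCommGroup E] [InnerProductSpace ℂ E] {d : ℕ}

/-- The `n`-th Taylor coefficient at `s = 0` of `e^{-is Ad F_d} ⋯ e^{-is Ad F_a} (B)`, where
`F_a, …, F_d` are the operators with index in `T`. -/
noncomputable def taylorCoeff (F : Fin d → E →L[ℂ] E) (T : Finset (Fin d)) (n : ℕ)
    (B : E →L[ℂ] E) : E →L[ℂ] E :=
  ((-Complex.I) ^ n / n.factorial) •
    ∑ q ∈ Finset.piAntidiag T n, (Nat.multinomial T q : ℂ) • nestedComm F q B

theorem taylorCoeff_empty (F : Fin d → E →L[ℂ] E) (n : ℕ) (B : E →L[ℂ] E) :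
    taylorCoeff F ∅ n B = if n = 0 then B else 0 := by
  rw [taylorCoeff]
  split_ifs with h
  · subst h; simp [nestedComm_zero]
  · simp [h]

theorem norm_factor (n : ℕ) : ‖(-Complex.I) ^ n / (n.factorial : ℂ)‖ = 1 / n.factorial := by
  rw [norm_div, norm_pow, norm_neg, Complex.norm_I, one_pow, Complex.norm_natCast]

theorem piAntidiag_eq_zero_of_lt {T : Finset (Fin d)} {a : Fin d} (h : ∀ x ∈ T, x < a) {n : ℕ}
    {q : Fin d → ℕ} (hq : q ∈ Finset.piAntidiag T n) (j : Fin d) (hj : a ≤ j) : q j = 0 := by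
  by_contra h0
  exact (h j ((Finset.mem_piAntidiag.1 hq).2 j h0)).not_ge hj

/-- The Cauchy product of the exponential series of the outermost factor `e^{-is Ad F_a}` with the
expansion of the inner factors. -/
theorem taylorCoeff_insert (F : Fin d → E →L[ℂ] E) {T : Finset (Fin d)} {a : Fin d}
    (h : ∀ x ∈ T, x < a) (n : ℕ) (B : E →L[ℂ] E) :
    taylorCoeff F (insert a T) n B = ∑ m ∈ Finset.range (n + 1),
      (((n - m).factorial : ℂ)⁻¹ • (((-Complex.I) • Ad (F a)) ^ (n - m)) (taylorCoeff F T m B)) := by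
  have ha : a ∉ T := fun h0 => (h a h0).false
  rw [taylorCoeff, sum_piAntidiag_insert ha, Finset.smul_sum]
  refine Finset.sum_congr rfl fun m hm => ?_
  have hm' : m ≤ n := Nat.lt_succ_iff.1 (Finset.mem_range.1 hm)
  rw [taylorCoeff, smul_pow, LinearMap.smul_apply, map_smul, map_sum, smul_smul, smul_smul,
    Finset.smul_sum, Finset.smul_sum]
  refine Finset.sum_congr rfl fun q hq => ?_
  rw [multinomial_insert_update ha hq hm',
    nestedComm_update F q a _ (piAntidiag_eq_zero_of_lt h hq), map_smul, smul_smul, smul_smul]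
  congr 1
  have h1 : (n.choose m : ℂ) * m.factorial * (n - m).factorial = n.factorial := by
    exact_mod_cast Nat.choose_mul_factorial_mul_factorial hm'
  have h2 : ((-Complex.I) ^ n) = (-Complex.I) ^ (n - m) * (-Complex.I) ^ m := by
    rw [← pow_add, Nat.sub_add_cancel hm']
  have e1 : (m.factorial : ℂ) ≠ 0 := by exact_mod_cast m.factorial_ne_zero
  have e2 : ((n - m).factorial : ℂ) ≠ 0 := by exact_mod_cast (n - m).factorial_ne_zero
  have e3 : (n.choose m : ℂ) ≠ 0 := by exact_mod_cast (Nat.choose_pos hm').ne'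
  push_cast
  rw [h2, ← h1]
  field_simp

theorem norm_map_taylorCoeff_le (F : Fin d → E →L[ℂ] E) (T : Finset (Fin d)) (n : ℕ)
    (B : E →L[ℂ] E) (Λ : Module.End ℂ (E →L[ℂ] E)) {M : (E →L[ℂ] E) → ℝ}
    (hM : ∀ q ∈ Finset.piAntidiag T n, ‖Λ (nestedComm F q B)‖ ≤ M (nestedComm F q B)) :
    ‖Λ (taylorCoeff F T n B)‖ ≤ 1 / n.factorial *
      ∑ q ∈ Finset.piAntidiag T n, (Nat.multinomial T q : ℝ) * M (nestedComm F q B) := by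
  rw [taylorCoeff, map_smul, norm_smul, norm_factor, map_sum]
  refine mul_le_mul_of_nonneg_left (norm_sum_le_of_le _ fun q hq => ?_) (by positivity)
  rw [map_smul, norm_smul, Complex.norm_natCast]
  exact mul_le_mul_of_nonneg_left (hM q hq) (by positivity)

variable [FiniteDimensional ℂ E]

theorem hasDerivAt_map {V : Type*} [NormedAddCommGroup V] [NormedSpace ℂ V]
    [FiniteDimensional ℂ V] (Λ : V →ₗ[ℂ] V) {f : ℝ → V} {f' : V} {s : ℝ}
    (hf : HasDerivAt f f' s) : HasDerivAt (fun s => Λ (f s)) (Λ f') s :=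
  ((LinearMap.toContinuousLinearMap Λ).restrictScalars ℝ).hasFDerivAt.comp_hasDerivAt s hf

/-- The Taylor expansion of `e^{-is Ad F_d} ⋯ e^{-is Ad F_a} (B)`; the remainder is bounded through
the nested commutators of order `N`, after conjugation with ordered exponentials. -/
theorem norm_map_conj_orderedExp_sub_taylor_le [CompleteSpace E] {F : Fin d → E →L[ℂ] E}
    (hF : ∀ a, IsSelfAdjoint (F a)) (B : E →L[ℂ] E) (Λ : Module.End ℂ (E →L[ℂ] E))
    {M : (E →L[ℂ] E) → ℝ} {s t : ℝ} (hs : s ∈ Set.Icc 0 t)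
    (hM : ∀ τ : Fin d → ℝ, (∀ j, τ j ∈ Set.Icc 0 t) → ∀ Y,
      ‖Λ (conj (orderedExp F τ) Y)‖ ≤ M Y)
    (T : Finset (Fin d)) (τ : Fin d → ℝ) (hτ : ∀ j, τ j ∈ Set.Icc 0 t)
    (hτT : ∀ i ∈ T, ∀ j ≤ i, τ j = 0) (N : ℕ) :
    ‖Λ (conj (orderedExp F τ) (conj (orderedExp F fun j => if j ∈ T then s else 0) B -
        ∑ n ∈ Finset.range N, ((s : ℂ) ^ n) • taylorCoeff F T n B))‖ ≤
      s ^ N / N.factorial *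
        ∑ q ∈ Finset.piAntidiag T N, (Nat.multinomial T q : ℝ) * M (nestedComm F q B) := by
  have hs0 : 0 ≤ s := hs.1
  induction T using Finset.induction_on_max generalizing τ N with
  | empty =>
    rw [orderedExp_of_eq_zero F (τ := fun j => if j ∈ (∅ : Finset (Fin d)) then s else 0) (by simp),
      conj_one]
    rcases Nat.eq_zero_or_pos N with rfl | hN
    · simpa [nestedComm_zero] using hM τ hτ B
    · have : ∑ n ∈ Finset.range N, ((s : ℂ) ^ n) • taylorCoeff F ∅ n B = B := by
        rw [Finset.sum_eq_single_of_mem 0 (Finset.mem_range.2 hN) fun n _ hn => by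
          simp [taylorCoeff_empty, hn]]
        simp [taylorCoeff_empty]
      simp [this, ← conjLin_apply, hN.ne']
  | insert a T hlt ih =>
    have haT : a ∉ T := fun h0 => (hlt a h0).false
    set Z := conj (orderedExp F fun j => if j ∈ T then s else 0) B with hZ
    set e : ℕ → E →L[ℂ] E := fun n => taylorCoeff F T n B with he
    set L : Module.End ℂ (E →L[ℂ] E) := (-Complex.I) • Ad (F a) with hL
    have hu : ∀ τ, IsUnit (orderedExp F τ) := fun τ =>
      isUnit_of_mem_unitary (orderedExp_mem_unitary hF τ)
    -- the outermost exponential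
    have hsplit : conj (orderedExp F fun j => if j ∈ insert a T then s else 0) B =
        conj (evol (F a) s) Z := by
      rw [orderedExp_eq_evol_mul F _ a, hZ, ← conj_mul (isUnit_evol _ _) (hu _)]
      · congr 2
        · simp
        · congr 1
          funext j
          rcases eq_or_ne j a with rfl | hj
          · simp [haT]
          · simp [hj]
      · intro j hj
        have h1 : j ≠ a := hj.ne'
        have h2 : j ∉ T := fun h => (hlt j h).not_ge hj.le
        simp [h1, h2]
    have hτa : τ a = 0 := hτT a (Finset.mem_insert_self _ _) a le_rfl
    -- Since `τ` vanishes at all indices up to `a`, the exponential of `F a` becomes the rightmost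
    -- factor of an ordered exponential with time `σ` at `a`. Keeping `τ` general in the induction
    -- is what makes this possible.
    have hmerge : ∀ (σ : ℝ) Y, conj (orderedExp F τ) (conj (evol (F a) σ) Y) =
        conj (orderedExp F (Function.update τ a σ)) Y := by
      intro σ Y
      rw [orderedExp_eq_mul_evol F (Function.update τ a σ) a, conj_mul (hu _) (isUnit_evol _ _)]
      · congr 2
        · rw [Function.update_idem, ← hτa, Function.update_eq_self]
        · simp
      · intro j hj
        rw [Function.update_of_ne hj.ne]
        exact hτT a (Finset.mem_insert_self _ _) j hj.le
    have hτ' : ∀ σ ∈ Set.Icc 0 t, ∀ j, Function.update τ a σ j ∈ Set.Icc 0 t := by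
      intro σ hσ j
      rcases eq_or_ne j a with rfl | hj
      · simpa using hσ
      · simpa [hj] using hτ j
    -- regroup the Taylor polynomial
    have hpoly : ∑ n ∈ Finset.range N, ((s : ℂ) ^ n) • taylorCoeff F (insert a T) n B =
        ∑ m ∈ Finset.range N, ((s : ℂ) ^ m) • ∑ r ∈ Finset.range (N - m),
          ((s ^ r / r.factorial : ℝ) : ℂ) • (L ^ r) (e m) := by
      simp only [Finset.smul_sum, smul_smul]
      rw [← Finset.sum_range_diag_flip]
      refine Finset.sum_congr rfl fun n _ => ?_
      rw [taylorCoeff_insert F hlt, Finset.smul_sum]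
      refine Finset.sum_congr rfl fun m hm => ?_
      rw [smul_smul]
      congr 1
      have : s ^ n = s ^ m * s ^ (n - m) := by
        rw [← pow_add, Nat.add_sub_cancel' (Nat.lt_succ_iff.1 (Finset.mem_range.1 hm))]
      have : (s : ℂ) ^ n = (s : ℂ) ^ m * (s : ℂ) ^ (n - m) := by exact_mod_cast this
      push_cast
      rw [this]
      ring
    -- The remainder is the evolved remainder of the inner factors plus, for each inner coefficient
    -- `e m`, the order `N - m` remainder of the outer exponential.
    have hdecomp : conj (orderedExp F τ)
          (conj (orderedExp F fun j => if j ∈ insert a T then s else 0) B -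
          ∑ n ∈ Finset.range N, ((s : ℂ) ^ n) • taylorCoeff F (insert a T) n B) =
        conj (orderedExp F (Function.update τ a s))
          (Z - ∑ m ∈ Finset.range N, ((s : ℂ) ^ m) • e m) +
        ∑ m ∈ Finset.range N, ((s : ℂ) ^ m) • conj (orderedExp F τ) (conj (evol (F a) s) (e m) -
          ∑ r ∈ Finset.range (N - m), ((s ^ r / r.factorial : ℝ) : ℂ) • (L ^ r) (e m)) := by
      rw [hsplit, hpoly, ← hmerge]
      simp only [← conjLin_apply, map_sub, map_sum, map_smul, smul_sub, Finset.sum_sub_distrib]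
      abel
    have hfirst := ih (Function.update τ a s) (hτ' s hs) (fun i hi j hj => by
      have hja : j < a := hj.trans_lt (hlt i hi)
      rw [Function.update_of_ne hja.ne]
      exact hτT i (Finset.mem_insert_of_mem hi) j hj) N
    set S : ℕ → ℝ := fun m => ∑ q ∈ Finset.piAntidiag T m,
      (Nat.multinomial T q : ℝ) * M ((Ad (F a) ^ (N - m)) (nestedComm F q B)) with hS
    have hterm : ∀ m ∈ Finset.range N, ‖Λ (conj (orderedExp F τ) (conj (evol (F a) s) (e m) -
          ∑ r ∈ Finset.range (N - m), ((s ^ r / r.factorial : ℝ) : ℂ) • (L ^ r) (e m)))‖ ≤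
        1 / m.factorial * S m * s ^ (N - m) / (N - m).factorial := by
      intro m _
      set Λ' : Module.End ℂ (E →L[ℂ] E) := Λ ∘ₗ conjLin (orderedExp F τ)
      have hT := norm_sub_taylor_le (N - m)
        (fun r σ => Λ' (conj (evol (F a) σ) ((L ^ r) (e m)))) (fun r σ => by
          rw [pow_succ', Module.End.mul_apply]
          exact hasDerivAt_map Λ' (hasDerivAt_conj_evol (F a) _ σ)) hs0
        (C := 1 / m.factorial * S m) (fun σ hσ => by
          have hσ' : σ ∈ Set.Icc 0 t := ⟨hσ.1, hσ.2.trans hs.2⟩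
          have h1 : Λ' (conj (evol (F a) σ) ((L ^ (N - m)) (e m))) =
              (-Complex.I) ^ (N - m) • (Λ ∘ₗ conjLin (orderedExp F (Function.update τ a σ)) ∘ₗ
                Ad (F a) ^ (N - m)) (e m) := by
            simp only [Λ', LinearMap.comp_apply, conjLin_apply, hmerge, hL, smul_pow,
              LinearMap.smul_apply]
            simp only [← conjLin_apply, map_smul]
          rw [h1, norm_smul, norm_pow, norm_neg, Complex.norm_I, one_pow, one_mul]
          refine norm_map_taylorCoeff_le F T m B _
            (M := fun Y => M ((Ad (F a) ^ (N - m)) Y)) fun q _ => ?_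
          simp only [LinearMap.comp_apply, conjLin_apply]
          exact hM _ (hτ' σ hσ') _)
      -- At `σ = 0` the derivatives in `hT` reduce to the images of `(L ^ r) (e m)`, so its left
      -- side is the remainder sought.
      refine le_trans (le_of_eq ?_) hT
      congr 1
      simp only [Λ', LinearMap.comp_apply, conjLin_apply, evol_zero, conj_one, pow_zero,
        Module.End.one_apply]
      simp only [← conjLin_apply, map_sub, map_sum, map_smul, ← Complex.coe_smul]
    have hrhs : ∑ q ∈ Finset.piAntidiag (insert a T) N,
        (Nat.multinomial (insert a T) q : ℝ) * M (nestedComm F q B) =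
        ∑ m ∈ Finset.range (N + 1), (N.choose m : ℝ) * S m := by
      rw [sum_piAntidiag_insert haT]
      refine Finset.sum_congr rfl fun m hm => ?_
      rw [hS, Finset.mul_sum]
      refine Finset.sum_congr rfl fun q hq => ?_
      rw [multinomial_insert_update haT hq (Nat.lt_succ_iff.1 (Finset.mem_range.1 hm)),
        nestedComm_update F q a _ (piAntidiag_eq_zero_of_lt hlt hq)]
      push_cast
      ring
    rw [hdecomp, map_add, map_sum, hrhs, Finset.sum_range_succ, mul_add, add_comm]
    have hlast : (N.choose N : ℝ) * S N = ∑ q ∈ Finset.piAntidiag T N,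
        (Nat.multinomial T q : ℝ) * M (nestedComm F q B) := by
      simp [hS]
    rw [hlast]
    refine (norm_add_le _ _).trans (add_le_add ?_ hfirst)
    rw [Finset.mul_sum]
    refine norm_sum_le_of_le _ fun m hm => ?_
    rw [map_smul, norm_smul, norm_pow, Complex.norm_real, Real.norm_of_nonneg hs0]
    refine (mul_le_mul_of_nonneg_left (hterm m hm) (by positivity)).trans (le_of_eq ?_)
    have hm' : m ≤ N := (Finset.mem_range.1 hm).le
    have h1 : (N.choose m : ℝ) * m.factorial * (N - m).factorial = N.factorial := by
      exact_mod_cast Nat.choose_mul_factorial_mul_factorial hm'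
    have h2 : s ^ N = s ^ m * s ^ (N - m) := by rw [← pow_add, Nat.add_sub_cancel' hm']
    have e1 : (m.factorial : ℝ) ≠ 0 := by positivity
    have e2 : ((N - m).factorial : ℝ) ≠ 0 := by positivity
    have e3 : (N.choose m : ℝ) ≠ 0 := by exact_mod_cast (Nat.choose_pos hm').ne'
    rw [h2, ← h1]
    field_simp

end Taylor

/-! ### The error generator, its Taylor coefficients and the commutator norms -/

section Commutators

variable {E : Type*} [NormedAddCommGroup E] [InnerProductSpace ℂ E] {d : ℕ}

theorem maxNorm_nonneg (F : Fin d → E →L[ℂ] E) (l : ℕ) (t : ℝ) (X : E →L[ℂ] E) :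
    0 ≤ maxNorm F l t X :=
  Real.iSup_nonneg fun _ => norm_nonneg _

theorem beta_nonneg (F : Fin d → E →L[ℂ] E) (n l : ℕ) (t : ℝ) : 0 ≤ beta F n l t :=
  Finset.sum_nonneg fun _ _ => Finset.sum_nonneg fun _ _ =>
    mul_nonneg (Nat.cast_nonneg _) (maxNorm_nonneg _ _ _ _)

theorem betaH_nonneg (F : Fin d → E →L[ℂ] E) (n l : ℕ) (t : ℝ) : 0 ≤ betaH F n l t :=
  Finset.sum_nonneg fun _ _ => mul_nonneg (Nat.cast_nonneg _) (beta_nonneg _ _ _ _)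

theorem alpha_nonneg (F : Fin d → E →L[ℂ] E) (n : ℕ) : 0 ≤ alpha F n :=
  Finset.sum_nonneg fun _ _ => Finset.sum_nonneg fun _ _ =>
    mul_nonneg (Nat.cast_nonneg _) (norm_nonneg _)

/-- No index lies above the last one, so its antidiagonal of positive weight is empty. -/
theorem sum_innerIdx_eq {G : Type*} [AddCommMonoid G] {n : ℕ} (hn : n ≠ 0)
    (f : Fin d → (Fin d → ℕ) → G) :
    ∑ b ∈ innerIdx d, ∑ q ∈ Finset.piAntidiag (Finset.Ioi b) n, f b q =
      ∑ b, ∑ q ∈ Finset.piAntidiag (Finset.Ioi b) n, f b q := by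
  refine Finset.sum_subset (Finset.subset_univ _) fun b _ hb => ?_
  have hemp : Finset.Ioi b = ∅ := by
    ext j
    simp only [innerIdx, Finset.mem_filter, Finset.mem_univ, true_and, not_lt] at hb
    simp only [Finset.mem_Ioi, Finset.notMem_empty, iff_false, not_lt, Fin.le_def]
    omega
  rw [hemp, Finset.piAntidiag_empty_of_ne_zero hn, Finset.sum_empty]

theorem prodFormula_zero (F : Fin d → E →L[ℂ] E) : prodFormula F 0 = 1 :=
  orderedExp_of_eq_zero F fun _ => rfl

/-- The deviation of the generator of the product formula from `H`. -/
noncomputable def errOp (F : Fin d → E →L[ℂ] E) (s : ℝ) : E →L[ℂ] E := effHam F s - ham F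

/-- The Taylor coefficients of `errOp F` at zero. -/
noncomputable def errCoeff (F : Fin d → E →L[ℂ] E) (n : ℕ) : E →L[ℂ] E :=
  if n = 0 then 0 else ∑ b, taylorCoeff F (Finset.Ioi b) n (F b)

variable [CompleteSpace E] {F : Fin d → E →L[ℂ] E}

theorem maxNorm_zero_left (hF : ∀ a, IsSelfAdjoint (F a)) {t : ℝ} (ht : 0 ≤ t)
    (X : E →L[ℂ] E) : maxNorm F 0 t X = ‖X‖ := by
  have : Nonempty {τ : Fin d → ℝ // ∀ a, τ a ∈ Set.Icc 0 t} := ⟨⟨fun _ => 0, fun _ => ⟨le_rfl, ht⟩⟩⟩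
  simp [maxNorm, norm_conj (orderedExp_mem_unitary hF _)]

/-- Without powers of `Ad_H` the conjugation is isometric, so the maximum over `Γ(t)` does not
depend on `t`. -/
theorem beta_zero_right (hF : ∀ a, IsSelfAdjoint (F a)) (n : ℕ) {t : ℝ} (ht : 0 ≤ t) :
    beta F n 0 t = alpha F n := by
  simp only [beta, alpha, maxNorm_zero_left hF ht]

theorem isSelfAdjoint_ham (hF : ∀ a, IsSelfAdjoint (F a)) : IsSelfAdjoint (ham F) :=
  isSelfAdjoint_sum _ fun a _ => hF a

theorem prodFormula_mem_unitary (hF : ∀ a, IsSelfAdjoint (F a)) (s : ℝ) :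
    prodFormula F s ∈ unitary (E →L[ℂ] E) := orderedExp_mem_unitary hF _

theorem norm_evol_mul (hF : ∀ a, IsSelfAdjoint (F a)) (s : ℝ) (X : E →L[ℂ] E) :
    ‖evol (ham F) s * X‖ = ‖X‖ :=
  CStarRing.norm_mem_unitary_mul _ (evol_mem_unitary (isSelfAdjoint_ham hF) s)

theorem norm_mul_prodFormula (hF : ∀ a, IsSelfAdjoint (F a)) (s : ℝ) (X : E →L[ℂ] E) :
    ‖X * prodFormula F s‖ = ‖X‖ :=
  CStarRing.norm_mul_mem_unitary _ (prodFormula_mem_unitary hF s)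

theorem hasDerivAt_evol_neg (X : E →L[ℂ] E) (s : ℝ) :
    HasDerivAt (fun s => evol X (-s)) (Complex.I • (evol X (-s) * X)) s := by
  have := (hasDerivAt_evol X (-s)).scomp s (hasDerivAt_neg s)
  simpa [Function.comp_def, (commute_evol X (-s)).eq] using this

/-- In the interaction picture, the product formula is generated by `errOp`. -/
theorem hasDerivAt_evol_neg_mul_prodFormula (hF : ∀ a, IsSelfAdjoint (F a)) (s : ℝ) :
    HasDerivAt (fun s => evol (ham F) (-s) * prodFormula F s)
      ((-Complex.I) • (evol (ham F) (-s) * errOp F s * prodFormula F s)) s := by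
  refine ((hasDerivAt_evol_neg (ham F) s).mul (hasDerivAt_prodFormula hF s)).congr_deriv ?_
  rw [errOp]
  simp only [mul_sub, sub_mul, smul_mul_assoc, mul_smul_comm, smul_sub, neg_smul, mul_neg, mul_assoc]
  abel

variable [FiniteDimensional ℂ E]

/-- Boundedness makes the supremum in `maxNorm` a genuine one: a power of `Ad_H` is continuous in
finite dimension and the conjugations are isometric. -/
theorem bddAbove_norm_Ad_pow_conj (hF : ∀ a, IsSelfAdjoint (F a)) (l : ℕ) (t : ℝ)
    (X : E →L[ℂ] E) :
    BddAbove (Set.range fun τ : {τ : Fin d → ℝ // ∀ a, τ a ∈ Set.Icc 0 t} =>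
      ‖(Ad (ham F) ^ l) (conj (orderedExp F τ) X)‖) := by
  refine ⟨‖LinearMap.toContinuousLinearMap (Ad (ham F) ^ l)‖ * ‖X‖, ?_⟩
  rintro _ ⟨τ, rfl⟩
  have := (LinearMap.toContinuousLinearMap (Ad (ham F) ^ l)).le_opNorm (conj (orderedExp F τ) X)
  rwa [norm_conj (orderedExp_mem_unitary hF _)] at this

theorem le_maxNorm (hF : ∀ a, IsSelfAdjoint (F a)) (l : ℕ) {t : ℝ} {τ : Fin d → ℝ}
    (hτ : ∀ a, τ a ∈ Set.Icc 0 t) (X : E →L[ℂ] E) :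
    ‖(Ad (ham F) ^ l) (conj (orderedExp F τ) X)‖ ≤ maxNorm F l t X :=
  le_ciSup (bddAbove_norm_Ad_pow_conj hF l t X) ⟨τ, hτ⟩

theorem norm_Ad_pow_le_maxNorm (hF : ∀ a, IsSelfAdjoint (F a)) (l : ℕ) {t : ℝ} (ht : 0 ≤ t)
    (X : E →L[ℂ] E) : ‖(Ad (ham F) ^ l) X‖ ≤ maxNorm F l t X := by
  have := le_maxNorm hF l (τ := fun _ => 0) (t := t) (fun _ => ⟨le_rfl, ht⟩) X
  rwa [orderedExp_of_eq_zero F fun _ => rfl, conj_one] at this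

theorem maxNorm_mono (hF : ∀ a, IsSelfAdjoint (F a)) (l : ℕ) {s t : ℝ} (hs : 0 ≤ s)
    (hst : s ≤ t) (X : E →L[ℂ] E) : maxNorm F l s X ≤ maxNorm F l t X := by
  have : Nonempty {τ : Fin d → ℝ // ∀ a, τ a ∈ Set.Icc 0 s} := ⟨⟨fun _ => 0, fun _ => ⟨le_rfl, hs⟩⟩⟩
  exact ciSup_le fun τ => le_maxNorm hF l (fun a => ⟨(τ.2 a).1, (τ.2 a).2.trans hst⟩) X

theorem beta_mono (hF : ∀ a, IsSelfAdjoint (F a)) (n l : ℕ) {s t : ℝ} (hs : 0 ≤ s)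
    (hst : s ≤ t) : beta F n l s ≤ beta F n l t :=
  Finset.sum_le_sum fun _ _ => Finset.sum_le_sum fun _ _ =>
    mul_le_mul_of_nonneg_left (maxNorm_mono hF l hs hst _) (Nat.cast_nonneg _)

/-- The general expansion is applied to each summand of `effHam`, starting from `τ = 0`. Subtracting
`H` removes exactly the zeroth coefficients, which is why `N ≠ 0` is needed. -/
theorem norm_Ad_pow_errOp_sub_taylor_le (hF : ∀ a, IsSelfAdjoint (F a)) (l : ℕ) {s t : ℝ}
    (hs : s ∈ Set.Icc 0 t) {N : ℕ} (hN : N ≠ 0) :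
    ‖(Ad (ham F) ^ l) (errOp F s - ∑ n ∈ Finset.range N, ((s : ℂ) ^ n) • errCoeff F n)‖ ≤
      s ^ N / N.factorial * beta F N l t := by
  have ht : 0 ≤ t := hs.1.trans hs.2
  have hdecomp : errOp F s - ∑ n ∈ Finset.range N, ((s : ℂ) ^ n) • errCoeff F n =
      ∑ b, (conj (orderedExp F fun j => if j ∈ Finset.Ioi b then s else 0) (F b) -
        ∑ n ∈ Finset.range N, ((s : ℂ) ^ n) • taylorCoeff F (Finset.Ioi b) n (F b)) := by
    obtain ⟨N, rfl⟩ := Nat.exists_eq_succ_of_ne_zero hN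
    have h0 : ∀ b, taylorCoeff F (Finset.Ioi b) 0 (F b) = F b := by
      intro b; simp [taylorCoeff, nestedComm_zero, Nat.multinomial]
    rw [errOp, effHam, ham, Finset.sum_sub_distrib, Finset.sum_comm]
    simp only [Nat.succ_eq_add_one, Finset.sum_range_succ', errCoeff, Nat.succ_ne_zero, if_false,
      if_true, pow_zero, one_smul, add_zero, h0, Finset.smul_sum]
    abel
  rw [hdecomp, map_sum, beta, sum_innerIdx_eq hN, Finset.mul_sum]
  refine norm_sum_le_of_le _ fun b _ => ?_
  have := norm_map_conj_orderedExp_sub_taylor_le hF (F b) (Ad (ham F) ^ l) (M := maxNorm F l t) hs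
    (fun τ hτ Y => le_maxNorm hF l hτ Y) (Finset.Ioi b) (fun _ => 0) (fun _ => ⟨le_rfl, ht⟩)
    (fun _ _ _ _ => rfl) N
  rwa [orderedExp_of_eq_zero F (τ := fun _ => 0) fun _ => rfl, conj_one] at this

theorem norm_Ad_pow_errCoeff_le (hF : ∀ a, IsSelfAdjoint (F a)) (n l : ℕ) {t : ℝ} (ht : 0 ≤ t) :
    ‖(Ad (ham F) ^ l) (errCoeff F n)‖ ≤ 1 / n.factorial * beta F n l t := by
  rw [errCoeff]
  split_ifs with hn
  · rw [map_zero, norm_zero]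
    exact mul_nonneg (by positivity) (beta_nonneg _ _ _ _)
  · rw [map_sum, beta, sum_innerIdx_eq hn, Finset.mul_sum]
    exact norm_sum_le_of_le _ fun b _ => norm_map_taylorCoeff_le F _ n _ _
      fun q _ => norm_Ad_pow_le_maxNorm hF l ht _

/-- For a product formula of order `p` the first `p` Taylor coefficients of `errOp` vanish. -/
theorem errCoeff_eq_zero (hF : ∀ a, IsSelfAdjoint (F a)) {p : ℕ} (hord : HasOrder F p) {m : ℕ}
    (hm : m < p) : errCoeff F m = 0 := by
  induction m using Nat.strong_induction_on with
  | _ m ih =>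
  set e := errCoeff F m with he
  set C : ℝ := beta F (m + 1) 0 1 / (m + 1).factorial with hC
  -- All lower coefficients vanish by induction, so `e` is the leading one. It is then identified in
  -- the interaction-picture product `T` below, where it would force `T s - 1` to be of order
  -- exactly `m + 1`.
  have hE : ∀ s ∈ Set.Icc (0 : ℝ) 1, ‖errOp F s - ((s : ℂ) ^ m) • e‖ ≤ s ^ m * (C * s) := by
    intro s hs
    have h := norm_Ad_pow_errOp_sub_taylor_le hF 0 hs (Nat.succ_ne_zero m)
    rw [Finset.sum_range_succ, Finset.sum_eq_zero fun j hj => by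
      rw [ih j (Finset.mem_range.1 hj) ((Finset.mem_range.1 hj).trans hm), smul_zero], zero_add,
      pow_zero, Module.End.one_apply] at h
    refine h.trans (le_of_eq ?_)
    rw [hC, Nat.succ_eq_add_one, pow_succ]
    ring
  set Ψ : ℝ → E →L[ℂ] E := fun s => evol (ham F) (-s) * e * prodFormula F s with hΨ
  have hΨ0 : Ψ 0 = e := by simp [hΨ, evol_zero, prodFormula_zero]
  have hΨc : ContinuousAt Ψ 0 :=
    (((hasDerivAt_evol_neg (ham F) 0).mul_const e).mul (hasDerivAt_prodFormula hF 0)).continuousAt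
  set g : ℝ → ℝ := fun s => C * s + ‖Ψ s - e‖ with hg
  have hgc : Tendsto g (𝓝 0) (𝓝 0) := by
    have h1 : ContinuousAt g 0 :=
      (continuousAt_const.mul continuousAt_id).add (hΨc.sub continuousAt_const).norm
    have h2 : g 0 = 0 := by simp [hg, hΨ0]
    simpa [ContinuousAt, h2] using h1
  set T : ℝ → E →L[ℂ] E := fun s => evol (ham F) (-s) * prodFormula F s with hT
  have hT' : ∀ s ∈ Set.Icc (0 : ℝ) 1,
      ‖(-Complex.I) • (evol (ham F) (-s) * errOp F s * prodFormula F s) +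
        (Complex.I * (s : ℂ) ^ m) • e‖ ≤ s ^ m * g s := by
    intro s hs
    have h1 : (-Complex.I) • (evol (ham F) (-s) * errOp F s * prodFormula F s) +
        (Complex.I * (s : ℂ) ^ m) • e = (-Complex.I) •
          (evol (ham F) (-s) * (errOp F s - ((s : ℂ) ^ m) • e) * prodFormula F s +
            ((s : ℂ) ^ m) • (Ψ s - e)) := by
      simp only [hΨ, mul_sub, sub_mul, smul_sub, smul_add, mul_smul_comm, smul_mul_assoc, smul_smul,
        neg_smul, neg_mul]
      abel
    rw [h1, norm_smul, norm_neg, Complex.norm_I, one_mul]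
    refine (norm_add_le _ _).trans ?_
    rw [norm_mul_prodFormula hF, norm_evol_mul hF, norm_smul, norm_pow, Complex.norm_real,
      Real.norm_of_nonneg hs.1, hg, mul_add]
    exact add_le_add (hE s hs) le_rfl
  obtain ⟨K, hK⟩ := hord.bound
  have key : ∀ ε > 0, ‖e‖ ≤ ε := by
    intro ε hε
    obtain ⟨δ, hδ, hgδ⟩ := Metric.eventually_nhds_iff.1 (hgc.eventually (gt_mem_nhds hε))
    -- Integrating the derivative of `T` gives `T s = 1 - i e s^{m+1}/(m+1) + o(s^{m+1})`.
    have hsmall : ∀ s ∈ Set.Ioo (0 : ℝ) (min δ 1),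
        ‖T s - 1 + (Complex.I * ((s ^ (m + 1) / (m + 1) : ℝ) : ℂ)) • e‖ ≤
          ε * (s ^ (m + 1) / (m + 1)) := by
      intro s hs
      have hpow : ∀ σ : ℝ, HasDerivAt (fun σ : ℝ => σ ^ (m + 1) / (m + 1)) (σ ^ m) σ := by
        intro σ
        refine ((hasDerivAt_pow (m + 1) σ).div_const ((m : ℝ) + 1)).congr_deriv ?_
        have : (m : ℝ) + 1 ≠ 0 := by positivity
        push_cast
        field_simp
      have hder : ∀ σ : ℝ, HasDerivAt
          (fun σ => T σ - 1 + (Complex.I * ((σ ^ (m + 1) / (m + 1) : ℝ) : ℂ)) • e)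
          ((-Complex.I) • (evol (ham F) (-σ) * errOp F σ * prodFormula F σ) +
            (Complex.I * (σ : ℂ) ^ m) • e) σ := by
        intro σ
        have h1 := (hpow σ).ofReal_comp.const_mul Complex.I
        rw [Complex.ofReal_pow] at h1
        exact ((hasDerivAt_evol_neg_mul_prodFormula hF σ).sub_const 1).fun_add (h1.smul_const e)
      refine image_norm_le_of_norm_deriv_right_le_deriv_boundary (a := 0) (b := s)
        (B := fun σ => ε * (σ ^ (m + 1) / (m + 1))) (B' := fun σ => ε * σ ^ m)
        (fun σ _ => (hder σ).continuousAt.continuousWithinAt)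
        (fun σ _ => (hder σ).hasDerivWithinAt) ?_ (fun σ => (hpow σ).const_mul ε)
        (fun σ hσ => ?_) ⟨hs.1.le, le_rfl⟩
      · simp [hT, evol_zero, prodFormula_zero]
      · have hσ1 : σ ∈ Set.Icc (0 : ℝ) 1 := ⟨hσ.1, (hσ.2.trans (hs.2.trans_le (min_le_right _ _))).le⟩
        refine (hT' σ hσ1).trans ?_
        rw [mul_comm]
        refine mul_le_mul_of_nonneg_right (hgδ ?_).le (pow_nonneg hσ.1 _)
        rw [Real.dist_eq, sub_zero, abs_of_nonneg hσ.1]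
        exact hσ.2.trans (hs.2.trans_le (min_le_left _ _))
    -- The order hypothesis gives `T s - 1 = O(s^{p+1})`, hence `O(s^{m+2})` because `m < p`;
    -- dividing by `s^{m+1}/(m+1)` leaves `ε` plus a term that vanishes with `s`.
    have hev : ∀ᶠ s in 𝓝[>] (0 : ℝ), ‖e‖ ≤ ε + |K| * (m + 1) * s := by
      filter_upwards [nhdsWithin_le_nhds hK, Ioo_mem_nhdsGT (lt_min hδ one_pos)] with s hKs hs
      have hs0 := hs.1
      have hs1 : s ≤ 1 := (hs.2.trans_le (min_le_right _ _)).le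
      have h1 : ‖T s - 1‖ ≤ |K| * s ^ (m + 2) := by
        have h2 : T s - 1 = evol (ham F) (-s) * (prodFormula F s - evol (ham F) s) := by
          rw [mul_sub, evol_neg_mul_evol]
        rw [h2, norm_evol_mul hF]
        refine hKs.trans (mul_le_mul (le_abs_self K) ?_ (norm_nonneg _) (abs_nonneg _))
        rw [Real.norm_of_nonneg (by positivity)]
        exact pow_le_pow_of_le_one hs0.le hs1 (by omega)
      have h3 : ‖(Complex.I * ((s ^ (m + 1) / (m + 1) : ℝ) : ℂ)) • e‖ =
          s ^ (m + 1) / (m + 1) * ‖e‖ := by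
        rw [norm_smul, norm_mul, Complex.norm_I, one_mul, Complex.norm_real,
          Real.norm_of_nonneg (by positivity)]
      have h4 : s ^ (m + 1) / (m + 1) * ‖e‖ ≤
          ε * (s ^ (m + 1) / (m + 1)) + |K| * s ^ (m + 2) := by
        rw [← h3]
        calc _ = ‖(T s - 1 + (Complex.I * ((s ^ (m + 1) / (m + 1) : ℝ) : ℂ)) • e) -
              (T s - 1)‖ := by rw [add_sub_cancel_left]
          _ ≤ _ := (norm_sub_le _ _).trans (add_le_add (hsmall s hs) h1)
      have h5 : 0 < s ^ (m + 1) / ((m : ℝ) + 1) := by positivity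
      refine le_of_mul_le_mul_left (h4.trans (le_of_eq ?_)) h5
      field_simp
      ring
    have hlim : Tendsto (fun s : ℝ => ε + |K| * (m + 1) * s) (𝓝[>] 0) (𝓝 ε) := by
      have : ContinuousAt (fun s : ℝ => ε + |K| * (m + 1) * s) 0 := by fun_prop
      simpa [ContinuousAt] using this.mono_left (nhdsWithin_le_nhds (s := Set.Ioi 0))
    exact ge_of_tendsto hlim hev
  exact norm_le_zero_iff.1 (le_of_forall_pos_le_add fun ε hε => by simpa using key ε hε)

end Commutators

/-! ### Cancellation by the order conditions, and the quadrature error -/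

section MultiProduct

variable {V : Type*} [NormedAddCommGroup V] [NormedSpace ℝ V]

/-- The order conditions on the weights cancel every contribution of order between `p` and
`2p - 1` in the step size. -/
theorem sum_smul_taylor_eq_zero {r p l N : ℕ} (hlN : l + N = 2 * p) {k : Fin r → ℕ}
    {c : Fin r → ℝ} (hc0 : ∀ q ∈ Finset.Icc p (2 * p - 1), ∑ i, c i / (k i : ℝ) ^ q = 0)
    {e : ℕ → V} (he : ∀ m < p, e m = 0) (t x : ℝ) :
    ∑ i, (c i * (t / k i) ^ l) • ∑ m ∈ Finset.range N, ((x * (t / k i)) ^ m) • e m = 0 := by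
  simp only [Finset.smul_sum, smul_smul]
  rw [Finset.sum_comm]
  refine Finset.sum_eq_zero fun m hm => ?_
  rw [Finset.mem_range] at hm
  rw [← Finset.sum_smul]
  rcases lt_or_ge m p with h | h
  · rw [he m h, smul_zero]
  · have h1 : ∀ i, c i * (t / k i) ^ l * (x * (t / k i)) ^ m =
        t ^ (l + m) * x ^ m * (c i / (k i : ℝ) ^ (l + m)) := by
      intro i
      rw [div_pow, mul_pow, div_pow, pow_add, pow_add]
      ring
    -- Here `m ≥ p` and `m < N`, so `l + m` lies between `p` and `2p - 1`, the range of the order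
    -- conditions.
    rw [Finset.sum_congr rfl fun i _ => h1 i, ← Finset.mul_sum, hc0 _ (by
      rw [Finset.mem_Icc]; omega), mul_zero, zero_smul]

/-- A weighted sum of samples equals, by the order conditions, the weighted sum of the Taylor
remainders. -/
theorem norm_map_sum_smul_le {r p l N : ℕ} (hlN : l + N = 2 * p) {k : Fin r → ℕ}
    {c : Fin r → ℝ} (hc0 : ∀ q ∈ Finset.Icc p (2 * p - 1), ∑ i, c i / (k i : ℝ) ^ q = 0)
    {e : ℕ → V} (he : ∀ m < p, e m = 0) {Z : ℝ → V} {t x β : ℝ} (ht : 0 ≤ t)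
    (hx : x ∈ Set.Icc (0 : ℝ) 1) (hβ : 0 ≤ β) (Λ : Module.End ℝ V)
    (hZ : ∀ i, ‖Λ (Z (x * (t / k i)) - ∑ m ∈ Finset.range N, ((x * (t / k i)) ^ m) • e m)‖ ≤
      (x * (t / k i)) ^ N / N.factorial * β) :
    ‖Λ (∑ i, (c i * (t / k i) ^ l) • Z (x * (t / k i)))‖ ≤
      (∑ i, |c i| / (k i : ℝ) ^ (2 * p)) * t ^ (2 * p) * (β / N.factorial) := by
  have h0 : ∑ i, (c i * (t / k i) ^ l) • Z (x * (t / k i)) =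
      ∑ i, (c i * (t / k i) ^ l) • (Z (x * (t / k i)) -
        ∑ m ∈ Finset.range N, ((x * (t / k i)) ^ m) • e m) := by
    simp only [smul_sub, Finset.sum_sub_distrib, sum_smul_taylor_eq_zero hlN hc0 he t x, sub_zero]
  rw [h0, map_sum, Finset.sum_mul, Finset.sum_mul]
  refine norm_sum_le_of_le _ fun i _ => ?_
  have hh : 0 ≤ t / k i := by positivity
  rw [map_smul, norm_smul, Real.norm_eq_abs, abs_mul, abs_of_nonneg (pow_nonneg hh l)]
  have h1 : (x * (t / k i)) ^ N ≤ (t / k i) ^ N :=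
    pow_le_pow_left₀ (mul_nonneg hx.1 hh) (mul_le_of_le_one_left hh hx.2) N
  calc _ ≤ |c i| * (t / k i) ^ l * ((t / k i) ^ N / N.factorial * β) := by
        refine mul_le_mul_of_nonneg_left ((hZ i).trans ?_) (by positivity)
        gcongr
    _ = _ := by
        rw [show |c i| * (t / k i) ^ l * ((t / k i) ^ N / N.factorial * β) =
          |c i| * ((t / k i) ^ l * (t / k i) ^ N) * (β / N.factorial) by ring, ← pow_add, hlN,
          div_pow]
        ring

theorem sum_Icc_one_eq_sum_range {G : Type*} [AddCommMonoid G] (f : ℕ → G) (n : ℕ) :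
    ∑ l ∈ Finset.Icc 1 n, f l = ∑ l ∈ Finset.range n, f (l + 1) := by
  rw [Finset.range_eq_Ico, Finset.sum_Ico_add' f 0 n 1]
  rfl

variable [CompleteSpace V]

/-- Error bound for a weighted sum of `k i`-step rectangle rules with the step sizes `t / k i`. -/
theorem norm_integral_sum_orbit_le (φ : ℝ → V →ₗ[ℝ] V) (D : Module.End ℝ V)
    (hzero : ∀ Y, φ 0 Y = Y) (hadd : ∀ s t Y, φ (s + t) Y = φ s (φ t Y))
    (hder : ∀ Y s, HasDerivAt (fun s => φ s Y) (φ s (D Y)) s)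
    (hnorm : ∀ s Y, ‖φ s Y‖ = ‖Y‖) (hcomm : ∀ s Y, D (φ s Y) = φ s (D Y))
    {r n : ℕ} {k : Fin r → ℕ} (hk : ∀ i, 1 ≤ k i) {c : Fin r → ℝ}
    (hc0 : ∀ q ∈ Finset.Icc (n + 1) (2 * (n + 1) - 1), ∑ i, c i / (k i : ℝ) ^ q = 0)
    {e : ℕ → V} (he : ∀ m < n + 1, e m = 0) {Z : ℝ → V} {t τ : ℝ} (ht : 0 ≤ t)
    (hτ : ∀ i, t / k i ≤ τ) {b : ℕ → ℕ → ℝ} {b₀ : ℝ} (hb : ∀ N l, 0 ≤ b N l) (hb₀ : 0 ≤ b₀)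
    (hZ : ∀ N, N ≠ 0 → ∀ l, ∀ s ∈ Set.Icc 0 τ,
      ‖(D ^ l) (Z s - ∑ m ∈ Finset.range N, (s ^ m) • e m)‖ ≤ s ^ N / N.factorial * b N l)
    (hZ₀ : ∀ s ∈ Set.Icc 0 τ, ‖Z s - ∑ m ∈ Finset.range (2 * (n + 1)), (s ^ m) • e m‖ ≤
      s ^ (2 * (n + 1)) / (2 * (n + 1)).factorial * b₀)
    {θ : ℝ → ℝ} (hθ : ∀ x ∈ Set.Icc (0 : ℝ) 1, θ x ∈ Set.Icc (0 : ℝ) 1) {m : ℕ → ℝ}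
    (hm : ∀ l ∈ Finset.Icc 1 n, ∀ x ∈ Set.Icc (0 : ℝ) 1, |bernoulliFun l (θ x)| ≤ m l) {M : ℝ}
    (hM : ∀ y ∈ Set.Icc (0 : ℝ) 1, |bernoulliFun (n + 1) y| ≤ M) :
    ‖∫ x in (0 : ℝ)..1, ∑ i, c i • ((t / k i) •
        ∑ j ∈ Finset.range (k i), φ ((j + θ x) * (t / k i)) (Z (x * (t / k i))))‖ ≤
      (∑ i, |c i| / (k i : ℝ) ^ (2 * (n + 1))) * t ^ (2 * (n + 1)) *
        (t * (b₀ / (2 * (n + 1)).factorial)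
          + 2 * ∑ l ∈ Finset.Icc 1 n, m l * b (2 * (n + 1) - l) (l - 1) /
            (l.factorial * (2 * (n + 1) - l).factorial)
          + t * (2 * M / (n + 1).factorial) * (b (n + 1) (n + 1) / (n + 1).factorial) /
            (n + 1 + 1)) := by
  set p := n + 1 with hp
  set K := ∑ i, |c i| / (k i : ℝ) ^ (2 * p) with hK
  have hK0 : 0 ≤ K := Finset.sum_nonneg fun i _ => by positivity
  have hM0 : 0 ≤ M := (abs_nonneg _).trans (hM 0 (by simp))
  have hcont : ∀ Y, Continuous fun s => φ s Y := fun Y =>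
    continuous_iff_continuousAt.2 fun s => (hder Y s).continuousAt
  set A₀ := K * t ^ (2 * p) * (t * (b₀ / (2 * p).factorial)
    + 2 * ∑ l ∈ Finset.Icc 1 n, m l * b (2 * p - l) (l - 1) /
      (l.factorial * (2 * p - l).factorial)) with hA₀
  set A₁ := K * t ^ (2 * p) * (t * (2 * M / p.factorial) * (b p p / p.factorial)) with hA₁
  have hpt : ∀ x ∈ Set.Ioc (0 : ℝ) 1, ‖∑ i, c i • ((t / k i) •
      ∑ j ∈ Finset.range (k i), φ ((j + θ x) * (t / k i)) (Z (x * (t / k i))))‖ ≤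
        A₀ + A₁ * x ^ p := by
    intro x hx
    have hx' : x ∈ Set.Icc (0 : ℝ) 1 := ⟨hx.1.le, hx.2⟩
    have hh : ∀ i, 0 ≤ t / k i := fun i => by positivity
    have hmem : ∀ i, x * (t / k i) ∈ Set.Icc 0 τ := fun i =>
      ⟨mul_nonneg hx.1.le (hh i), (mul_le_of_le_one_left (hh i) hx.2).trans (hτ i)⟩
    have hkt : ∀ i, k i * (t / k i) = t := fun i => by
      have : (k i : ℝ) ≠ 0 := by have := hk i; positivity
      field_simp
    -- For fixed `x`, each rectangle sum is split into integral `I`, boundary terms `Q` and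
    -- remainder `R`. The range of integration `[0,t]` is the same for all `i`, since `k i * (t / k
    -- i) = t`, so the weights act on `Z` alone.
    set I : Fin r → V := fun i => ∫ s in (0 : ℝ)..t, φ s (Z (x * (t / k i))) with hI
    set Q : Fin r → V := fun i => ∑ l ∈ Finset.range n,
      (bernoulliFun (l + 1) (θ x) / (l + 1).factorial * (t / k i) ^ (l + 1)) •
        (φ t ((D ^ l) (Z (x * (t / k i)))) - (D ^ l) (Z (x * (t / k i)))) with hQ
    set R : Fin r → V := fun i => (t / k i) •
      ∑ j ∈ Finset.range (k i), φ ((j + θ x) * (t / k i)) (Z (x * (t / k i))) - I i - Q i with hR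
    have hsplit : ∑ i, c i • ((t / k i) •
        ∑ j ∈ Finset.range (k i), φ ((j + θ x) * (t / k i)) (Z (x * (t / k i)))) =
        ∑ i, c i • I i + ∑ i, c i • Q i + ∑ i, c i • R i := by
      rw [← Finset.sum_add_distrib, ← Finset.sum_add_distrib]
      refine Finset.sum_congr rfl fun i _ => ?_
      rw [← smul_add, ← smul_add, hR, ← add_sub_cancel (I i + Q i) (_ • ∑ j ∈ _, _), sub_add_eq_sub_sub]
    have hIb : ‖∑ i, c i • I i‖ ≤ K * t ^ (2 * p) * (t * (b₀ / (2 * p).factorial)) := by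
      have h1 : ∑ i, c i • I i =
          ∫ s in (0 : ℝ)..t, φ s (∑ i, (c i * (t / k i) ^ 0) • Z (x * (t / k i))) := by
        simp only [map_sum, map_smul, pow_zero, mul_one]
        rw [intervalIntegral.integral_finsetSum (f := fun i s => c i • φ s (Z (x * (t / k i))))
          fun i _ => ((hcont _).const_smul (c i)).intervalIntegrable _ _]
        simp only [intervalIntegral.integral_smul, hI]
      have h2 := norm_map_sum_smul_le (l := 0) (N := 2 * p) (by omega) hc0 he ht hx' hb₀ 1
        (fun i => hZ₀ _ (hmem i))
      rw [h1]
      refine (intervalIntegral.norm_integral_le_of_norm_le_const fun s _ =>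
        (hnorm s _).le.trans h2).trans (le_of_eq ?_)
      rw [sub_zero, abs_of_nonneg ht]
      ring
    have hQb : ‖∑ i, c i • Q i‖ ≤ K * t ^ (2 * p) * (2 * ∑ l ∈ Finset.Icc 1 n,
        m l * b (2 * p - l) (l - 1) / (l.factorial * (2 * p - l).factorial)) := by
      have h1 : ∑ i, c i • Q i = ∑ l ∈ Finset.range n,
          (bernoulliFun (l + 1) (θ x) / (l + 1).factorial) •
            (φ t ((D ^ l) (∑ i, (c i * (t / k i) ^ (l + 1)) • Z (x * (t / k i)))) -
              (D ^ l) (∑ i, (c i * (t / k i) ^ (l + 1)) • Z (x * (t / k i)))) := by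
        simp only [hQ, Finset.smul_sum, map_sum, map_smul, ← Finset.sum_sub_distrib, ← smul_sub,
          smul_smul]
        rw [Finset.sum_comm]
        refine Finset.sum_congr rfl fun l _ => Finset.sum_congr rfl fun i _ => ?_
        congr 1
        ring
      rw [h1, sum_Icc_one_eq_sum_range, Finset.mul_sum, Finset.mul_sum]
      refine norm_sum_le_of_le _ fun l hl => ?_
      rw [Finset.mem_range] at hl
      rw [norm_smul, norm_div, Real.norm_natCast, Real.norm_eq_abs, Nat.add_sub_cancel]
      -- The boundary term already carries `h^{l+1}`, so `Z` is expanded only to order `2p - (l+1)`.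
      have h2 := norm_map_sum_smul_le (l := l + 1) (N := 2 * p - (l + 1)) (by omega) hc0 he ht hx'
        (hb (2 * p - (l + 1)) l) (D ^ l) (fun i => hZ _ (by omega) l _ (hmem i))
      set Y := (D ^ l) (∑ i, (c i * (t / k i) ^ (l + 1)) • Z (x * (t / k i)))
      have h3 : ‖φ t Y - Y‖ ≤ 2 * ‖Y‖ := by
        refine (norm_sub_le _ _).trans (le_of_eq ?_)
        rw [hnorm, two_mul]
      have h4 := hm (l + 1) (by rw [Finset.mem_Icc]; omega) x hx'
      calc _ ≤ m (l + 1) / (l + 1).factorial * (2 * (K * t ^ (2 * p) *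
            (b (2 * p - (l + 1)) l / (2 * p - (l + 1)).factorial))) := by
            refine mul_le_mul (div_le_div_of_nonneg_right h4 (by positivity))
              (h3.trans (mul_le_mul_of_nonneg_left h2 zero_le_two)) (norm_nonneg _)
              (div_nonneg ((abs_nonneg _).trans h4) (by positivity))
        _ = _ := by
            field_simp
    -- Both factors `h^p` are present without cancellation. The power `x^p` is kept because its
    -- integral gives the `1/(p+1)` in the last term of the bound.
    have hRb : ‖∑ i, c i • R i‖ ≤ A₁ * x ^ p := by
      rw [hA₁, hK, Finset.sum_mul, Finset.sum_mul, Finset.sum_mul]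
      refine norm_sum_le_of_le _ fun i _ => ?_
      rw [norm_smul, Real.norm_eq_abs]
      have h1 := norm_sum_orbit_sub_le φ D hzero hadd hder hnorm hcomm (hh i) n (hθ x hx') hM
        (k i) (Z (x * (t / k i)))
      rw [hkt i] at h1
      have h2 := hZ p (Nat.succ_ne_zero n) p _ (hmem i)
      rw [Finset.sum_eq_zero fun j hj => by rw [he j (Finset.mem_range.1 hj), smul_zero],
        sub_zero] at h2
      calc _ ≤ |c i| * (t * (2 * M / p.factorial * ((t / k i) ^ p *
            ((x * (t / k i)) ^ p / p.factorial * b p p)))) := by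
            refine mul_le_mul_of_nonneg_left (h1.trans ?_) (abs_nonneg _)
            have := hh i
            gcongr
        _ = _ := by
            rw [mul_pow, div_pow, two_mul p, pow_add, pow_add]
            ring
    rw [hsplit]
    refine (norm_add₃_le ..).trans ?_
    rw [hA₀, mul_add (K * t ^ (2 * p))]
    exact add_le_add (add_le_add hIb hQb) hRb
  have hint := intervalIntegral.norm_integral_le_of_norm_le (μ := MeasureTheory.volume) zero_le_one
    (Filter.Eventually.of_forall hpt) (Continuous.intervalIntegrable (by fun_prop) _ _)
  refine hint.trans (le_of_eq ?_)
  rw [intervalIntegral.integral_add (Continuous.intervalIntegrable (by fun_prop) _ _)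
    (Continuous.intervalIntegrable (by fun_prop) _ _), intervalIntegral.integral_const,
    intervalIntegral.integral_const_mul, integral_pow, hA₀, hA₁, hp]
  simp
  ring

end MultiProduct

/-! ### The interaction picture: one step, many steps, and the trace-norm error -/

section Heisenberg

variable {E : Type*} [NormedAddCommGroup E] [InnerProductSpace ℂ E] {d : ℕ}

/-- Heisenberg evolution `e^{isH} Y e^{-isH}`. -/
noncomputable def heis (F : Fin d → E →L[ℂ] E) (s : ℝ) : (E →L[ℂ] E) →ₗ[ℝ] (E →L[ℂ] E) :=
  (conjLin (evol (ham F) (-s))).restrictScalars ℝ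

/-- The generator `i Ad_H` of the Heisenberg evolution. -/
noncomputable def heisGen (F : Fin d → E →L[ℂ] E) : Module.End ℝ (E →L[ℂ] E) :=
  (Complex.I • Ad (ham F)).restrictScalars ℝ

theorem heis_apply (F : Fin d → E →L[ℂ] E) (s : ℝ) (Y : E →L[ℂ] E) :
    heis F s Y = conj (evol (ham F) (-s)) Y := conjLin_apply _ _

theorem heisGen_apply (F : Fin d → E →L[ℂ] E) (Y : E →L[ℂ] E) :
    heisGen F Y = Complex.I • Ad (ham F) Y := rfl

theorem heisGen_pow_apply (F : Fin d → E →L[ℂ] E) (l : ℕ) (Y : E →L[ℂ] E) :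
    (heisGen F ^ l) Y = Complex.I ^ l • (Ad (ham F) ^ l) Y := by
  induction l with
  | zero => simp
  | succ l ih =>
    rw [pow_succ', Module.End.mul_apply, ih, heisGen_apply, map_smul, smul_smul, pow_succ' (Ad _),
      Module.End.mul_apply, pow_succ']

theorem norm_heisGen_pow_apply (F : Fin d → E →L[ℂ] E) (l : ℕ) (Y : E →L[ℂ] E) :
    ‖(heisGen F ^ l) Y‖ = ‖(Ad (ham F) ^ l) Y‖ := by
  rw [heisGen_pow_apply, norm_smul, norm_pow, Complex.norm_I, one_pow, one_mul]

theorem heis_zero (F : Fin d → E →L[ℂ] E) (Y : E →L[ℂ] E) : heis F 0 Y = Y := by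
  rw [heis_apply, neg_zero, evol_zero, conj_one]

theorem trace_mul_comm (A B : E →L[ℂ] E) :
    LinearMap.trace ℂ E ((A * B : E →L[ℂ] E) : E →ₗ[ℂ] E) =
      LinearMap.trace ℂ E ((B * A : E →L[ℂ] E) : E →ₗ[ℂ] E) :=
  LinearMap.trace_mul_comm ℂ (A : E →ₗ[ℂ] E) (B : E →ₗ[ℂ] E)

variable [CompleteSpace E] {F : Fin d → E →L[ℂ] E}

theorem star_evol {X : E →L[ℂ] E} (hX : IsSelfAdjoint X) (s : ℝ) :
    star (evol X s) = evol X (-s) := by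
  rw [← inverse_of_mem_unitary (evol_mem_unitary hX s), inverse_evol]

theorem heis_apply_eq_mul (F : Fin d → E →L[ℂ] E) (s : ℝ) (Y : E →L[ℂ] E) :
    heis F s Y = evol (ham F) (-s) * Y * evol (ham F) s := by
  rw [heis_apply, conj_evol, neg_neg]

theorem heis_add (F : Fin d → E →L[ℂ] E) (s t : ℝ) (Y : E →L[ℂ] E) :
    heis F (s + t) Y = heis F s (heis F t Y) := by
  rw [heis_apply, heis_apply, heis_apply, ← conj_mul (isUnit_evol _ _) (isUnit_evol _ _),
    ← evol_add, neg_add]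

theorem hasDerivAt_heis (F : Fin d → E →L[ℂ] E) (Y : E →L[ℂ] E) (s : ℝ) :
    HasDerivAt (fun s => heis F s Y) (heis F s (heisGen F Y)) s := by
  have h := (hasDerivAt_conj_evol (ham F) Y (-s)).scomp s (hasDerivAt_neg s)
  have hfun : (fun s => heis F s Y) = (fun s => conj (evol (ham F) s) Y) ∘ Neg.neg :=
    funext fun s => heis_apply F s Y
  rw [hfun]
  refine h.congr_deriv ?_
  rw [heis_apply, heisGen_apply, neg_one_smul, ← conjLin_apply, ← conjLin_apply, neg_smul, map_neg,
    neg_neg]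

theorem norm_heis (hF : ∀ a, IsSelfAdjoint (F a)) (s : ℝ) (Y : E →L[ℂ] E) :
    ‖heis F s Y‖ = ‖Y‖ := by
  rw [heis_apply, norm_conj (evol_mem_unitary (isSelfAdjoint_ham hF) _)]

theorem heisGen_heis (F : Fin d → E →L[ℂ] E) (s : ℝ) (Y : E →L[ℂ] E) :
    heisGen F (heis F s Y) = heis F s (heisGen F Y) := by
  rw [heisGen_apply, heis_apply, Ad_conj_evol, heis_apply, heisGen_apply, ← conjLin_apply,
    ← conjLin_apply, map_smul]

theorem heisGen_pow_heis (F : Fin d → E →L[ℂ] E) (l : ℕ) (s : ℝ) (Y : E →L[ℂ] E) :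
    (heisGen F ^ l) (heis F s Y) = heis F s ((heisGen F ^ l) Y) := by
  induction l with
  | zero => simp
  | succ l ih => rw [pow_succ', Module.End.mul_apply, ih, heisGen_heis, Module.End.mul_apply]

theorem continuous_evol (X : E →L[ℂ] E) : Continuous (evol X) :=
  continuous_iff_continuousAt.2 fun s => (hasDerivAt_evol X s).continuousAt

theorem continuous_effHam (hF : ∀ a, IsSelfAdjoint (F a)) : Continuous (effHam F) := by
  induction d with
  | zero =>
    have : effHam F = fun _ => 0 := by funext s; simp [effHam]
    rw [this]
    exact continuous_const
  | succ d ih =>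
    have : effHam F = fun s => F (Fin.last d) + evol (F (Fin.last d)) s *
        effHam (fun j => F j.castSucc) s * evol (F (Fin.last d)) (-s) := by
      funext s; rw [effHam_succ hF, conj_evol]
    rw [this]
    have h1 := continuous_evol (F (Fin.last d))
    have h2 := ih fun a => hF a.castSucc
    fun_prop

theorem continuous_errOp (hF : ∀ a, IsSelfAdjoint (F a)) : Continuous (errOp F) :=
  (continuous_effHam hF).sub continuous_const

theorem continuous_heis_errOp (hF : ∀ a, IsSelfAdjoint (F a)) :
    Continuous fun s => heis F s (errOp F s) := by
  simp only [heis_apply_eq_mul]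
  have h1 := continuous_evol (ham F)
  have h2 := continuous_errOp hF
  fun_prop

/-- One step of the product formula in the interaction picture. -/
noncomputable def stepOp (F : Fin d → E →L[ℂ] E) (h : ℝ) : E →L[ℂ] E :=
  evol (ham F) (-h) * prodFormula F h

/-- The first-order error of one step in the interaction picture. -/
noncomputable def stepErr (F : Fin d → E →L[ℂ] E) (h : ℝ) : E →L[ℂ] E :=
  ∫ s in (0 : ℝ)..h, heis F s (errOp F s)

/-- `n` steps of the product formula in the interaction picture. -/
noncomputable def stepsOp (F : Fin d → E →L[ℂ] E) (h : ℝ) (n : ℕ) : E →L[ℂ] E :=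
  evol (ham F) (-(n * h)) * prodFormula F h ^ n

theorem stepsOp_succ (F : Fin d → E →L[ℂ] E) (h : ℝ) (n : ℕ) :
    stepsOp F h (n + 1) = heis F (n * h) (stepOp F h) * stepsOp F h n := by
  have h2 := evol_mul_evol_neg (ham F) (n * h)
  rw [stepsOp, stepsOp, heis_apply_eq_mul, stepOp, pow_succ',
    show -(((n + 1 : ℕ) : ℝ) * h) = -(n * h) + -h by push_cast; ring, evol_add]
  simp only [mul_assoc]
  rw [← mul_assoc (evol (ham F) (n * h)), h2, one_mul]

variable [FiniteDimensional ℂ E]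

theorem norm_errOp_le (hF : ∀ a, IsSelfAdjoint (F a)) {p : ℕ} (hp : 1 ≤ p) (hord : HasOrder F p)
    {s : ℝ} (hs : 0 ≤ s) : ‖errOp F s‖ ≤ alpha F p * s ^ p / p.factorial := by
  have h := norm_Ad_pow_errOp_sub_taylor_le hF 0 (s := s) (t := s) ⟨hs, le_rfl⟩
    (Nat.one_le_iff_ne_zero.1 hp)
  rw [Finset.sum_eq_zero fun j hj => by
    rw [errCoeff_eq_zero hF hord (Finset.mem_range.1 hj), smul_zero], sub_zero, pow_zero,
    Module.End.one_apply, beta_zero_right hF _ hs] at h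
  exact h.trans (le_of_eq (by ring))

theorem norm_stepOp_sub_one_le (hF : ∀ a, IsSelfAdjoint (F a)) {p : ℕ} (hp : 1 ≤ p)
    (hord : HasOrder F p) {h : ℝ} (hh : 0 ≤ h) :
    ‖stepOp F h - 1‖ ≤ alpha F p * h ^ (p + 1) / (p + 1).factorial := by
  refine image_norm_le_of_norm_deriv_right_le_deriv_boundary (a := 0) (b := h)
    (f := fun s => stepOp F s - 1)
    (B := fun s => alpha F p * s ^ (p + 1) / (p + 1).factorial)
    (B' := fun s => alpha F p * s ^ p / p.factorial)
    (fun s _ => ((hasDerivAt_evol_neg_mul_prodFormula hF s).sub_const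
      1).continuousAt.continuousWithinAt)
    (fun s _ => ((hasDerivAt_evol_neg_mul_prodFormula hF s).sub_const 1).hasDerivWithinAt) ?_
    (fun s => ?_) (fun s hs => ?_) ⟨hh, le_rfl⟩
  · simp [stepOp, evol_zero, prodFormula_zero]
  · simpa only [mul_div_assoc] using (hasDerivAt_pow_succ_div_factorial p s).const_mul (alpha F p)
  · rw [norm_smul, norm_neg, Complex.norm_I, one_mul, norm_mul_prodFormula hF, norm_evol_mul hF]
    exact norm_errOp_le hF hp hord hs.1

/-- The derivative of the left side is `-i φ_s(E(s)) (stepOp F s - 1)`, a product of two small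
factors; the squared majorant grows at twice the rate needed. -/
theorem norm_stepOp_sub_one_add_le (hF : ∀ a, IsSelfAdjoint (F a)) {p : ℕ} (hp : 1 ≤ p)
    (hord : HasOrder F p) {h : ℝ} (hh : 0 ≤ h) :
    ‖stepOp F h - 1 - (-Complex.I) • stepErr F h‖ ≤
      (alpha F p * h ^ (p + 1) / (p + 1).factorial) ^ 2 := by
  have hα := alpha_nonneg F p
  have hder : ∀ s, HasDerivAt (fun s => stepOp F s - 1 - (-Complex.I) • stepErr F s)
      ((-Complex.I) • (evol (ham F) (-s) * errOp F s * prodFormula F s) -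
        (-Complex.I) • heis F s (errOp F s)) s := fun s =>
    ((hasDerivAt_evol_neg_mul_prodFormula hF s).sub_const 1).fun_sub
      ((intervalIntegral.integral_hasDerivAt_right
        ((continuous_heis_errOp hF).intervalIntegrable _ _)
        ((continuous_heis_errOp hF).stronglyMeasurableAtFilter _ _)
        (continuous_heis_errOp hF).continuousAt).const_smul (-Complex.I))
  refine image_norm_le_of_norm_deriv_right_le_deriv_boundary (a := 0) (b := h)
    (B := fun s => (alpha F p * s ^ (p + 1) / (p + 1).factorial) ^ 2)
    (B' := fun s => 2 * (alpha F p * s ^ (p + 1) / (p + 1).factorial) *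
      (alpha F p * s ^ p / p.factorial))
    (fun s _ => (hder s).continuousAt.continuousWithinAt)
    (fun s _ => (hder s).hasDerivWithinAt) ?_ (fun s => ?_) (fun s hs => ?_) ⟨hh, le_rfl⟩
  · simp [stepOp, stepErr, evol_zero, prodFormula_zero]
  · have h1 := (hasDerivAt_pow_succ_div_factorial p s).const_mul (alpha F p)
    simpa [mul_div_assoc] using h1.fun_pow 2
  · have h1 : (-Complex.I) • (evol (ham F) (-s) * errOp F s * prodFormula F s) -
        (-Complex.I) • heis F s (errOp F s) =
        (-Complex.I) • (heis F s (errOp F s) * (stepOp F s - 1)) := by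
      have h2 := evol_mul_evol_neg (ham F) s
      rw [← smul_sub, heis_apply_eq_mul, stepOp, mul_sub, mul_one]
      congr 2
      simp only [mul_assoc]
      rw [← mul_assoc (evol (ham F) s), h2, one_mul]
    have hs0 := hs.1
    rw [h1, norm_smul, norm_neg, Complex.norm_I, one_mul]
    refine (norm_mul_le _ _).trans ?_
    rw [norm_heis hF]
    have hA : 0 ≤ alpha F p * s ^ p / p.factorial := by positivity
    have hB : 0 ≤ alpha F p * s ^ (p + 1) / (p + 1).factorial := by positivity
    refine (mul_le_mul (norm_errOp_le hF hp hord hs0) (norm_stepOp_sub_one_le hF hp hord hs0)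
      (norm_nonneg _) hA).trans ?_
    nlinarith [mul_nonneg hA hB]

/-- Errors of successive steps add, by unitarity. At second order a new step adds the cross term
`nδ²` and its own `δ²`, and `n² + n + 1 ≤ (n+1)²`. -/
theorem norm_stepsOp_sub_one_le (hF : ∀ a, IsSelfAdjoint (F a)) {p : ℕ} (hp : 1 ≤ p)
    (hord : HasOrder F p) {h : ℝ} (hh : 0 ≤ h) (n : ℕ) :
    ‖stepsOp F h n - 1‖ ≤ n * (alpha F p * h ^ (p + 1) / (p + 1).factorial) ∧
      ‖stepsOp F h n - 1 - (-Complex.I) • ∑ j ∈ Finset.range n, heis F (j * h) (stepErr F h)‖ ≤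
        (n * (alpha F p * h ^ (p + 1) / (p + 1).factorial)) ^ 2 := by
  set δ := alpha F p * h ^ (p + 1) / (p + 1).factorial
  have hδ : 0 ≤ δ := by
    have := alpha_nonneg F p
    positivity
  have hone : ∀ s, heis F s 1 = 1 := fun s => by
    rw [heis_apply_eq_mul, mul_one, evol_neg_mul_evol]
  have hsm : ∀ s Y, heis F s ((-Complex.I) • Y) = (-Complex.I) • heis F s Y := fun s Y => by
    rw [heis_apply, heis_apply, ← conjLin_apply, ← conjLin_apply, map_smul]
  induction n with
  | zero => simp [stepsOp, evol_zero]
  | succ n ih =>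
    obtain ⟨ih1, ih2⟩ := ih
    set X := stepsOp F h n
    set T := heis F (n * h) (stepOp F h)
    set Y := ∑ j ∈ Finset.range n, heis F (j * h) (stepErr F h)
    have hT1 : ‖T - 1‖ ≤ δ := by
      rw [← hone (n * h), ← map_sub, norm_heis hF]
      exact norm_stepOp_sub_one_le hF hp hord hh
    have hT2 : ‖T - 1 - (-Complex.I) • heis F (n * h) (stepErr F h)‖ ≤ δ ^ 2 := by
      rw [← hone (n * h), ← hsm, ← map_sub, ← map_sub, norm_heis hF]
      exact norm_stepOp_sub_one_add_le hF hp hord hh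
    have hprod : ‖(T - 1) * (X - 1)‖ ≤ δ * (n * δ) :=
      (norm_mul_le _ _).trans (mul_le_mul hT1 ih1 (norm_nonneg _) hδ)
    have hX : X ∈ unitary (E →L[ℂ] E) := mul_mem (evol_mem_unitary (isSelfAdjoint_ham hF) _)
      (pow_mem (prodFormula_mem_unitary hF h) n)
    rw [stepsOp_succ, Finset.sum_range_succ]
    constructor
    · have hX1 : ‖(T - 1) * X‖ ≤ δ := by
        rwa [CStarRing.norm_mul_mem_unitary _ hX]
      rw [show T * X - 1 = (T - 1) * X + (X - 1) by noncomm_ring]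
      refine (norm_add_le _ _).trans ((add_le_add hX1 ih1).trans (le_of_eq ?_))
      push_cast
      ring
    · rw [smul_add, show T * X - 1 - ((-Complex.I) • Y +
          (-Complex.I) • heis F (n * h) (stepErr F h)) = (T - 1) * (X - 1) +
          (T - 1 - (-Complex.I) • heis F (n * h) (stepErr F h)) +
          (X - 1 - (-Complex.I) • Y) by
        simp only [mul_sub, sub_mul, mul_one, one_mul]; abel]
      refine (norm_add₃_le ..).trans ((add_le_add (add_le_add hprod hT2) ih2).trans ?_)
      push_cast
      have : (0 : ℝ) ≤ n * δ ^ 2 := by positivity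
      nlinarith

/-- The trace-norm error of a multi-product formula, up to second order in the interaction
picture. -/
theorem traceNorm_mpf_sub_exactState_le (hF : ∀ a, IsSelfAdjoint (F a)) {ρ : E →L[ℂ] E}
    (hρ : IsDensity ρ) {p : ℕ} (hp : 1 ≤ p) (hord : HasOrder F p) {r : ℕ} {k : Fin r → ℕ}
    (hk : ∀ i, 1 ≤ k i) {c : Fin r → ℝ} (hc1 : ∑ i, c i = 1) {t : ℝ} (ht : 0 ≤ t) :
    traceNorm (mpf F ρ k c t - exactState F ρ t) ≤
      (∑ i, |c i| / (k i : ℝ) ^ (2 * p)) *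
        (3 * (alpha F p / (p + 1).factorial) ^ 2 * t ^ (2 * p + 2)) +
      2 * ‖∑ i, c i • ∑ j ∈ Finset.range (k i),
        heis F (j * (t / k i)) (stepErr F (t / k i))‖ := by
  refine traceNorm_le_of_forall fun W hW => ?_
  have hH := isSelfAdjoint_ham hF
  -- By cyclicity of the trace the exact evolution is moved from the states to the observable,
  -- leaving `X* W' X - W'` tested against the initial state.
  set W' := evol (ham F) (-t) * W * evol (ham F) t with hW'
  have hW'1 : ‖W'‖ ≤ 1 := by
    rw [hW', ← heis_apply_eq_mul, norm_heis hF]; exact hW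
  set X : Fin r → E →L[ℂ] E := fun i => stepsOp F (t / k i) (k i) with hX
  set Y : Fin r → E →L[ℂ] E := fun i => ∑ j ∈ Finset.range (k i),
    heis F (j * (t / k i)) (stepErr F (t / k i)) with hY
  set Q : Fin r → E →L[ℂ] E := fun i => (-Complex.I) • Y i with hQ
  have hkt : ∀ i, k i * (t / k i) = t := fun i => by
    have : (k i : ℝ) ≠ 0 := by have := hk i; positivity
    field_simp
  have htr : LinearMap.trace ℂ E ((W * (mpf F ρ k c t - exactState F ρ t) : E →L[ℂ] E) :
        E →ₗ[ℂ] E) =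
      LinearMap.trace ℂ E (((∑ i, (c i : ℂ) • (star (X i) * W' * X i - W')) * ρ : E →L[ℂ] E) :
        E →ₗ[ℂ] E) := by
    have h1 : ∀ i, LinearMap.trace ℂ E ((W * trotterState F ρ (k i) t : E →L[ℂ] E) : E →ₗ[ℂ] E) =
        LinearMap.trace ℂ E ((star (X i) * W' * X i * ρ : E →L[ℂ] E) : E →ₗ[ℂ] E) := by
      intro i
      have hV := pow_mem (prodFormula_mem_unitary hF (t / k i)) (k i)
      set S := prodFormula F (t / k i) ^ k i with hS
      have h2 : X i = evol (ham F) (-t) * S := by rw [hX]; simp only [stepsOp, hkt, hS]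
      have h3 : star (X i) * W' * X i = star S * W * S := by
        have e1 := evol_mul_evol_neg (ham F) t
        rw [h2, hW', star_mul, star_evol hH, neg_neg]
        simp only [mul_assoc]
        rw [← mul_assoc (evol (ham F) t) (evol (ham F) (-t)) S, e1, one_mul,
          ← mul_assoc (evol (ham F) t) (evol (ham F) (-t)) (W * S), e1, one_mul]
      rw [trotterState, conj_of_mem_unitary hV, h3, ← mul_assoc, trace_mul_comm]
      simp only [mul_assoc]
    have h4 : LinearMap.trace ℂ E ((W * exactState F ρ t : E →L[ℂ] E) : E →ₗ[ℂ] E) =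
        LinearMap.trace ℂ E ((W' * ρ : E →L[ℂ] E) : E →ₗ[ℂ] E) := by
      rw [exactState, ← mul_assoc, trace_mul_comm, hW']
      simp only [mul_assoc]
    have hc1' : ∑ i, (c i : ℂ) = 1 := by exact_mod_cast hc1
    rw [mul_sub, mpf, Finset.mul_sum, Finset.sum_mul]
    simp only [mul_smul_comm, smul_mul_assoc, sub_mul, ContinuousLinearMap.toLinearMap_sub,
      ContinuousLinearMap.toLinearMap_sum, ContinuousLinearMap.toLinearMap_smul, map_sub, map_sum, map_smul, h1, h4, smul_sub,
      Finset.sum_sub_distrib, ← Finset.sum_smul, hc1', one_smul]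
  rw [htr]
  refine (norm_trace_mul_density_le hρ _).trans ?_
  set R : Fin r → E →L[ℂ] E := fun i => star (X i - 1) * W' * (X i - 1) +
    star (X i - 1 - Q i) * W' + W' * (X i - 1 - Q i) with hR
  -- With `X = 1 + Q + (second order)`, everything but `Q* W' + W' Q` goes into `R`, whose three
  -- summands are each at most `ε²`. The weights are summed before norms are taken in the
  -- first-order part, so that cancellation remains available.
  have hdecomp : ∑ i, (c i : ℂ) • (star (X i) * W' * X i - W') =
      ∑ i, (c i : ℂ) • R i +
        (star ((-Complex.I) • ∑ i, c i • Y i) * W' + W' * ((-Complex.I) • ∑ i, c i • Y i)) := by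
    have h1 : (-Complex.I) • ∑ i, c i • Y i = ∑ i, (c i : ℂ) • Q i := by
      rw [Finset.smul_sum]
      refine Finset.sum_congr rfl fun i _ => ?_
      rw [hQ, ← Complex.coe_smul, smul_comm]
    rw [h1, star_sum, Finset.sum_mul, Finset.mul_sum, ← Finset.sum_add_distrib,
      ← Finset.sum_add_distrib]
    refine Finset.sum_congr rfl fun i _ => ?_
    rw [star_smul, Complex.star_def, Complex.conj_ofReal, smul_mul_assoc, mul_smul_comm, ← smul_add,
      ← smul_add, hR]
    congr 1
    simp only [star_sub, star_one]
    noncomm_ring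
  rw [hdecomp]
  refine (norm_add_le _ _).trans (add_le_add ?_ ?_)
  · rw [Finset.sum_mul]
    refine norm_sum_le_of_le _ fun i _ => ?_
    have hh : 0 ≤ t / k i := by positivity
    obtain ⟨hX1, hX2⟩ := norm_stepsOp_sub_one_le hF hp hord hh (k i)
    set ε := k i * (alpha F p * (t / k i) ^ (p + 1) / (p + 1).factorial) with hε
    have hε0 : 0 ≤ ε := (norm_nonneg _).trans hX1
    have b1 : ‖star (X i - 1) * W' * (X i - 1)‖ ≤ ε * 1 * ε :=
      (norm_mul_le _ _).trans (mul_le_mul ((norm_mul_le _ _).trans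
        (mul_le_mul (by rw [norm_star]; exact hX1) hW'1 (norm_nonneg _) hε0)) hX1
        (norm_nonneg _) (by positivity))
    have b2 : ‖star (X i - 1 - Q i) * W'‖ ≤ ε ^ 2 * 1 :=
      (norm_mul_le _ _).trans (mul_le_mul (by rw [norm_star]; exact hX2) hW'1 (norm_nonneg _)
        (by positivity))
    have b3 : ‖W' * (X i - 1 - Q i)‖ ≤ 1 * ε ^ 2 :=
      (norm_mul_le _ _).trans (mul_le_mul hW'1 hX2 (norm_nonneg _) zero_le_one)
    have hRb : ‖R i‖ ≤ 3 * ε ^ 2 := (norm_add₃_le ..).trans (by linarith)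
    rw [norm_smul, Complex.norm_real, Real.norm_eq_abs]
    refine (mul_le_mul_of_nonneg_left hRb (abs_nonneg _)).trans (le_of_eq ?_)
    have hki : (k i : ℝ) ≠ 0 := by have := hk i; positivity
    rw [hε, div_pow]
    have e1 : (k i : ℝ) ^ (p + 1) = k i ^ p * k i := pow_succ _ _
    have e2 : (k i : ℝ) ^ (2 * p) = (k i ^ p) ^ 2 := by rw [← pow_mul, mul_comm]
    have e3 : t ^ (2 * p + 2) = (t ^ (p + 1)) ^ 2 := by rw [← pow_mul]; congr 1; ring
    rw [e1, e2, e3]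
    field_simp
  · have hn : ‖(-Complex.I) • ∑ i, c i • Y i‖ = ‖∑ i, c i • Y i‖ := by
      rw [norm_smul, norm_neg, Complex.norm_I, one_mul]
    have b1 := (norm_mul_le (star ((-Complex.I) • ∑ i, c i • Y i)) W').trans
      (mul_le_mul_of_nonneg_left hW'1 (norm_nonneg _))
    have b2 := (norm_mul_le W' ((-Complex.I) • ∑ i, c i • Y i)).trans
      (mul_le_mul_of_nonneg_right hW'1 (norm_nonneg _))
    rw [norm_star, hn] at b1
    rw [hn] at b2
    exact (norm_add_le _ _).trans (by linarith)

end Heisenberg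

/-! ### The two error bounds -/

section Final

variable {E : Type*} [NormedAddCommGroup E] [InnerProductSpace ℂ E] {d : ℕ}

/-- The Taylor coefficients at zero of `heis F s (errOp F s)`. -/
noncomputable def heisErrCoeff (F : Fin d → E →L[ℂ] E) (m : ℕ) : E →L[ℂ] E :=
  ∑ n ∈ Finset.range (m + 1), (1 / (m - n).factorial : ℝ) • (heisGen F ^ (m - n)) (errCoeff F n)

theorem betaH_eq_add_sum (F : Fin d → E →L[ℂ] E) (N l : ℕ) (t : ℝ) :
    betaH F N l t = beta F N l t +
      ∑ n ∈ Finset.range N, (N.choose n : ℝ) * beta F n (l + (N - n)) t := by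
  rw [betaH, ← Finset.sum_range_reflect, Finset.sum_range_succ, add_comm]
  simp only [Nat.add_sub_cancel, Nat.sub_self, Nat.choose_zero_right, Nat.cast_one, one_mul,
    Nat.sub_zero, add_zero]
  congr 1
  refine Finset.sum_congr rfl fun n hn => ?_
  have hn' : n ≤ N := (Finset.mem_range.1 hn).le
  rw [Nat.choose_symm hn', Nat.sub_sub_self hn']

variable [CompleteSpace E] [FiniteDimensional ℂ E] {F : Fin d → E →L[ℂ] E}

theorem heisErrCoeff_eq_zero (hF : ∀ a, IsSelfAdjoint (F a)) {p : ℕ} (hord : HasOrder F p) {m : ℕ}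
    (hm : m < p) : heisErrCoeff F m = 0 := by
  refine Finset.sum_eq_zero fun n hn => ?_
  rw [errCoeff_eq_zero hF hord (by rw [Finset.mem_range] at hn; omega), map_zero, smul_zero]

theorem norm_heisGen_pow_errOp_sub_taylor_le (hF : ∀ a, IsSelfAdjoint (F a)) (l : ℕ) {s t : ℝ}
    (hs : s ∈ Set.Icc 0 t) {N : ℕ} (hN : N ≠ 0) :
    ‖(heisGen F ^ l) (errOp F s - ∑ n ∈ Finset.range N, (s ^ n) • errCoeff F n)‖ ≤
      s ^ N / N.factorial * beta F N l t := by
  rw [norm_heisGen_pow_apply]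
  refine le_trans (le_of_eq ?_) (norm_Ad_pow_errOp_sub_taylor_le hF l hs hN)
  simp only [← Complex.ofReal_pow, Complex.coe_smul]

/-- The isometry `heis F s` is applied to the Taylor remainder of `errOp`, and is itself expanded on
each Taylor coefficient. The latter terms involve no exponentials of the `F a`, so their norms are
taken at time zero. -/
theorem norm_heisGen_pow_heis_errOp_sub_taylor_le (hF : ∀ a, IsSelfAdjoint (F a)) (l : ℕ)
    {s t : ℝ} (hs : s ∈ Set.Icc 0 t) {N : ℕ} (hN : N ≠ 0) :
    ‖(heisGen F ^ l) (heis F s (errOp F s) -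
      ∑ m ∈ Finset.range N, (s ^ m) • heisErrCoeff F m)‖ ≤
      s ^ N / N.factorial * (beta F N l t +
        ∑ n ∈ Finset.range N, (N.choose n : ℝ) * beta F n (l + (N - n)) 0) := by
  have hs0 := hs.1
  set D := heisGen F
  set e := errCoeff F
  have hpoly : ∑ m ∈ Finset.range N, (s ^ m) • heisErrCoeff F m =
      ∑ n ∈ Finset.range N, (s ^ n) • ∑ r ∈ Finset.range (N - n),
        (s ^ r / r.factorial) • (D ^ r) (e n) := by
    simp only [Finset.smul_sum, smul_smul]
    rw [← Finset.sum_range_diag_flip]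
    refine Finset.sum_congr rfl fun m _ => ?_
    rw [heisErrCoeff, Finset.smul_sum]
    refine Finset.sum_congr rfl fun n hn => ?_
    rw [smul_smul]
    congr 1
    have : s ^ m = s ^ n * s ^ (m - n) := by
      rw [← pow_add, Nat.add_sub_cancel' (Nat.lt_succ_iff.1 (Finset.mem_range.1 hn))]
    rw [this]
    ring
  have hdecomp : (D ^ l) (heis F s (errOp F s) -
      ∑ m ∈ Finset.range N, (s ^ m) • heisErrCoeff F m) =
      heis F s ((D ^ l) (errOp F s - ∑ n ∈ Finset.range N, (s ^ n) • e n)) +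
      ∑ n ∈ Finset.range N, (s ^ n) • (heis F s ((D ^ l) (e n)) -
        ∑ r ∈ Finset.range (N - n), (s ^ r / r.factorial) • (D ^ r) ((D ^ l) (e n))) := by
    have hc : ∀ r, (D ^ r) ∘ₗ (D ^ l) = (D ^ l) ∘ₗ (D ^ r) := fun r =>
      (Commute.pow_pow (Commute.refl D) r l).eq
    have hc' : ∀ r Y, (D ^ r) ((D ^ l) Y) = (D ^ l) ((D ^ r) Y) := fun r Y =>
      LinearMap.congr_fun (hc r) Y
    rw [hpoly]
    simp only [hc', ← heisGen_pow_heis, map_sub, map_sum, map_smul, smul_sub,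
      Finset.sum_sub_distrib, D]
    abel
  rw [hdecomp, mul_add, Finset.mul_sum]
  refine (norm_add_le _ _).trans (add_le_add ?_ (norm_sum_le_of_le _ fun n hn => ?_))
  · rw [norm_heis hF]
    exact norm_heisGen_pow_errOp_sub_taylor_le hF l hs hN
  · have hT := norm_sub_taylor_le (N - n) (fun r σ => heis F σ ((D ^ r) ((D ^ l) (e n))))
      (fun r σ => by
        rw [pow_succ', Module.End.mul_apply]
        exact hasDerivAt_heis F _ σ) hs0
      (C := 1 / n.factorial * beta F n (l + (N - n)) 0) (fun σ _ => by
        rw [norm_heis hF, ← Module.End.mul_apply, ← pow_add, norm_heisGen_pow_apply,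
          add_comm (N - n)]
        exact norm_Ad_pow_errCoeff_le hF n _ le_rfl)
    simp only [heis_zero, pow_zero, Module.End.one_apply] at hT
    rw [norm_smul, norm_pow, Real.norm_of_nonneg hs0]
    refine (mul_le_mul_of_nonneg_left hT (by positivity)).trans (le_of_eq ?_)
    have hn' : n ≤ N := (Finset.mem_range.1 hn).le
    have h1 : (N.choose n : ℝ) * n.factorial * (N - n).factorial = N.factorial := by
      exact_mod_cast Nat.choose_mul_factorial_mul_factorial hn'
    have h2 : s ^ N = s ^ n * s ^ (N - n) := by rw [← pow_add, Nat.add_sub_cancel' hn']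
    have e1 : (n.factorial : ℝ) ≠ 0 := by positivity
    have e2 : ((N - n).factorial : ℝ) ≠ 0 := by positivity
    have e3 : (N.choose n : ℝ) ≠ 0 := by exact_mod_cast (Nat.choose_pos hn').ne'
    rw [h2, ← h1]
    field_simp

/-- Rescaling all step integrals to `x ∈ [0,1]` aligns the different step sizes, so that for fixed
`x` the order conditions apply across `i`. -/
theorem sum_stepErr_eq_integral (hF : ∀ a, IsSelfAdjoint (F a)) {r : ℕ} (k : Fin r → ℕ)
    (c h : Fin r → ℝ) :
    ∑ i, c i • ∑ j ∈ Finset.range (k i), heis F (j * h i) (stepErr F (h i)) =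
      ∫ x in (0 : ℝ)..1, ∑ i, c i • (h i • ∑ j ∈ Finset.range (k i),
        heis F (j * h i) (heis F (x * h i) (errOp F (x * h i)))) := by
  have hg := continuous_heis_errOp hF
  have hcont : ∀ i (j : ℕ), Continuous fun x : ℝ =>
      heis F (j * h i) (heis F (x * h i) (errOp F (x * h i))) := by
    intro i j
    have h1 : Continuous fun x : ℝ => heis F (x * h i) (errOp F (x * h i)) :=
      hg.comp (continuous_id.mul continuous_const)
    simp only [heis_apply_eq_mul F (j * h i)]
    fun_prop
  have hcomm : ∀ i (j : ℕ), heis F (j * h i) (stepErr F (h i)) =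
      h i • ∫ x in (0 : ℝ)..1, heis F (j * h i) (heis F (x * h i) (errOp F (x * h i))) := by
    intro i j
    have h1 : stepErr F (h i) =
        h i • ∫ x in (0 : ℝ)..1, heis F (x * h i) (errOp F (x * h i)) := by
      have := intervalIntegral.smul_integral_comp_mul_right (a := 0) (b := 1)
        (fun s => heis F s (errOp F s)) (h i)
      rw [stepErr, this, zero_mul, one_mul]
    rw [h1, map_smul]
    congr 1
    exact ((LinearMap.toContinuousLinearMap (heis F (j * h i))).intervalIntegral_comp_comm
      ((hg.comp (continuous_id.mul continuous_const)).intervalIntegrable 0 1)).symm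
  rw [intervalIntegral.integral_finsetSum (f := fun i x => c i • (h i • ∑ j ∈ Finset.range (k i),
    heis F (j * h i) (heis F (x * h i) (errOp F (x * h i))))) fun i _ =>
      Continuous.intervalIntegrable (by
        have h1 := continuous_finsetSum (Finset.range (k i)) fun j _ => hcont i j
        fun_prop) _ _]
  refine Finset.sum_congr rfl fun i _ => ?_
  rw [intervalIntegral.integral_smul, intervalIntegral.integral_smul,
    intervalIntegral.integral_finsetSum (f := fun (j : ℕ) x =>
      heis F (j * h i) (heis F (x * h i) (errOp F (x * h i))))
      fun j _ => (hcont i j).intervalIntegrable _ _, Finset.smul_sum]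
  simp only [hcomm, Finset.smul_sum]

/-- `|B_l(x)|` on `[0, 1]` is at most `|B_l|`, except for odd `l ≥ 3`. -/
theorem abs_bernoulliFun_le_add {l : ℕ} (hl : 1 ≤ l) {x : ℝ} (hx : x ∈ Set.Icc (0 : ℝ) 1) :
    |bernoulliFun l x| ≤ |((bernoulli l : ℚ) : ℝ)| +
      if 3 ≤ l ∧ Odd l then bernoulliMax l else 0 := by
  rcases eq_or_lt_of_le hl with rfl | hl2
  · rw [if_neg (by omega), add_zero, bernoulliFun_one, bernoulli_one]
    norm_num
    exact abs_le.2 ⟨by linarith [hx.1], by linarith [hx.2]⟩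
  rcases Nat.even_or_odd l with he | ho
  · rw [if_neg fun h => (Nat.not_odd_iff_even.2 he) h.2, add_zero]
    exact abs_bernoulliFun_le_of_even hl2 he hx
  · have h3 : 3 ≤ l := by
      obtain ⟨m, rfl⟩ := ho
      omega
    rw [if_pos ⟨h3, ho⟩]
    have := abs_bernoulliFun_le_bernoulliMax l hx
    have := abs_nonneg ((bernoulli l : ℚ) : ℝ)
    linarith

theorem beta_term_nonneg {b : ℕ → ℕ → ℝ → ℝ} (hb : ∀ N l t, 0 ≤ b N l t) (p : ℕ) (τ : ℝ) (l : ℕ) :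
    0 ≤ b (2 * p - l) (l - 1) τ / (l.factorial * (2 * p - l).factorial) :=
  div_nonneg (hb _ _ _) (by positivity)

theorem sum_Icc_le_a₃ {b : ℕ → ℕ → ℝ → ℝ} (hb : ∀ N l t, 0 ≤ b N l t) (n : ℕ) (τ : ℝ) :
    4 * ∑ l ∈ Finset.Icc 1 n, |((bernoulli l : ℚ) : ℝ)| * b (2 * (n + 1) - l) (l - 1) τ /
      (l.factorial * (2 * (n + 1) - l).factorial) ≤ a₃ b (n + 1) τ := by
  rw [a₃]
  refine mul_le_mul_of_nonneg_left (Finset.sum_le_sum_of_subset_of_nonneg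
    (Finset.Icc_subset_Icc_right n.le_succ) fun l _ _ => ?_) (by norm_num)
  rw [mul_div_assoc]
  exact mul_nonneg (abs_nonneg _) (beta_term_nonneg hb _ _ _)

theorem sum_Icc_le_a₃_add_a₃odd {b : ℕ → ℕ → ℝ → ℝ} (hb : ∀ N l t, 0 ≤ b N l t) (n : ℕ) (τ : ℝ) :
    4 * ∑ l ∈ Finset.Icc 1 n, (|((bernoulli l : ℚ) : ℝ)| +
        if 3 ≤ l ∧ Odd l then bernoulliMax l else 0) * b (2 * (n + 1) - l) (l - 1) τ /
      (l.factorial * (2 * (n + 1) - l).factorial) ≤ a₃ b (n + 1) τ + a₃odd b (n + 1) τ := by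
  simp only [add_mul, add_div, Finset.sum_add_distrib]
  rw [mul_add]
  refine add_le_add (sum_Icc_le_a₃ hb n τ) (le_of_eq ?_)
  rw [a₃odd, Finset.sum_filter]
  congr 1
  have hsub : Finset.Ico 3 (n + 1) ⊆ Finset.Icc 1 n := by
    intro l hl
    rw [Finset.mem_Ico] at hl
    rw [Finset.mem_Icc]
    omega
  rw [← Finset.sum_subset hsub fun l hl hl' => by
    rw [Finset.mem_Icc] at hl
    rw [Finset.mem_Ico] at hl'
    rw [if_neg (by omega), zero_mul, zero_div]]
  refine Finset.sum_congr rfl fun l hl => ?_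
  rw [Finset.mem_Ico] at hl
  by_cases ho : Odd l
  · rw [if_pos ⟨hl.1, ho⟩, if_pos ho]
  · rw [if_neg fun h => ho h.2, if_neg ho, zero_mul, zero_div]

/-- The second-order and the quadrature contributions are dominated by `8 (α/(p+1)!)²`, `a₂` and
`A`. -/
theorem error_constants_le {b : ℕ → ℕ → ℝ → ℝ} (hb : ∀ N l t, 0 ≤ b N l t) {n : ℕ}
    {α K t τ S A err J : ℝ} (hK : 0 ≤ K) (ht : 0 ≤ t) (hS : 4 * S ≤ A)
    (herr : err ≤ K * (3 * (α / (n + 1 + 1).factorial) ^ 2 * t ^ (2 * (n + 1) + 2)) + 2 * J)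
    (hJ : J ≤ K * t ^ (2 * (n + 1)) * (t * (b (2 * (n + 1)) 0 0 / (2 * (n + 1)).factorial) + 2 * S +
      t * (2 * ((n + 1).factorial * (2 * ((n + 1 : ℕ) + 1) / (2 * Real.pi) ^ (n + 1))) /
        (n + 1).factorial) * (b (n + 1) (n + 1) τ / (n + 1).factorial) / (n + 1 + 1))) :
    err ≤ K * (8 * (α / (n + 1 + 1).factorial) ^ 2 * t ^ (2 * (n + 1) + 2) +
      a₂ b (n + 1) τ * t ^ (2 * (n + 1) + 1) + A * t ^ (2 * (n + 1))) := by
  have hpi := Real.pi_pos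
  set q := (2 * Real.pi) ^ (n + 1) with hq
  have hq0 : 0 < q := by positivity
  set f : ℝ := ((n + 1).factorial : ℝ) with hf
  have hf0 : 0 < f := by positivity
  set b₀ := b (2 * (n + 1)) 0 0 / (2 * (n + 1)).factorial with hb₀
  have hb₀0 : 0 ≤ b₀ := div_nonneg (hb _ _ _) (by positivity)
  -- The factor `p + 1` from the Bernoulli bound cancels the `p + 1` from integrating `x^p`.
  have hlast : t * (2 * (f * (2 * ((n + 1 : ℕ) + 1) / q)) / f) *
      (b (n + 1) (n + 1) τ / f) / (n + 1 + 1) = t * (4 * b (n + 1) (n + 1) τ / (q * f)) := by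
    have : (n : ℝ) + 1 + 1 ≠ 0 := by positivity
    push_cast
    field_simp
    ring
  rw [hlast] at hJ
  set u := b (n + 1) (n + 1) τ / (q * f) with hu
  have e1 : 4 * b (n + 1) (n + 1) τ / (q * f) = 4 * u := by rw [hu]; ring
  have e2 : a₂ b (n + 1) τ = 4 * b₀ + 8 * u := by
    rw [a₂, hu, hb₀, ← hq, ← hf]; ring
  rw [e1] at hJ
  rw [e2]
  set g := (α / (n + 1 + 1).factorial) ^ 2
  have hg : 0 ≤ g := sq_nonneg _
  have hT : 0 ≤ t ^ (2 * (n + 1)) := by positivity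
  calc err ≤ K * (3 * g * t ^ (2 * (n + 1) + 2)) + 2 * (K * t ^ (2 * (n + 1)) *
        (t * b₀ + 2 * S + t * (4 * u))) := by linarith
    _ = K * (3 * g * t ^ (2 * (n + 1) + 2) + (2 * b₀ + 8 * u) * t ^ (2 * (n + 1) + 1) +
        (4 * S) * t ^ (2 * (n + 1))) := by rw [pow_succ t (2 * (n + 1))]; ring
    -- The slack is `3 ≤ 8` in the quadratic term and `2 ≤ 4` in front of `b₀`.
    _ ≤ _ := by
        gcongr
        · norm_num
        · norm_num

theorem traceNorm_mpf_sub_exactState_le_beta (hF : ∀ a, IsSelfAdjoint (F a)) {ρ : E →L[ℂ] E}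
    (hρ : IsDensity ρ) {n : ℕ} (hord : HasOrder F (n + 1)) {r : ℕ} {k : Fin r → ℕ}
    (hk : ∀ i, 1 ≤ k i) {c : Fin r → ℝ} (hc1 : ∑ i, c i = 1)
    (hc0 : ∀ q ∈ Finset.Icc (n + 1) (2 * (n + 1) - 1), ∑ i, c i / (k i : ℝ) ^ q = 0)
    {t τ : ℝ} (ht : 0 ≤ t) (hτ : ∀ i, t / k i ≤ τ) (hτ0 : 0 ≤ τ) :
    traceNorm (mpf F ρ k c t - exactState F ρ t) ≤
      (∑ i, |c i| / (k i : ℝ) ^ (2 * (n + 1))) *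
        (a₁ F (n + 1) * t ^ (2 * (n + 1) + 2) + a₂ (beta F) (n + 1) τ * t ^ (2 * (n + 1) + 1) +
          (a₃ (beta F) (n + 1) τ + a₃odd (beta F) (n + 1) τ) * t ^ (2 * (n + 1))) := by
  have hJ := norm_integral_sum_orbit_le (heis F) (heisGen F) (heis_zero F) (heis_add F)
    (hasDerivAt_heis F) (norm_heis hF) (heisGen_heis F) hk hc0
    (fun m hm => errCoeff_eq_zero hF hord hm) (Z := errOp F) ht hτ (b := fun N l => beta F N l τ)
    (b₀ := beta F (2 * (n + 1)) 0 0) (fun N l => beta_nonneg _ _ _ _) (beta_nonneg _ _ _ _)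
    (fun N hN l s hs => norm_heisGen_pow_errOp_sub_taylor_le hF l hs hN)
    (fun s hs => by
      rw [beta_zero_right hF _ le_rfl, ← beta_zero_right hF _ hτ0]
      exact norm_heisGen_pow_errOp_sub_taylor_le hF 0 hs (by omega))
    -- The phase `x` stays in the sampling points, so Bernoulli polynomials occur at arbitrary `x`;
    -- for odd `l ≥ 3` they are not controlled by `B_l`, whence `a₃odd`.
    (θ := fun x => x) (fun x hx => hx)
    (fun l hl x hx => abs_bernoulliFun_le_add (Finset.mem_Icc.1 hl).1 hx)
    (fun y hy => abs_bernoulliFun_div_factorial_le n.succ_pos hy)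
  have herr := traceNorm_mpf_sub_exactState_le hF hρ n.succ_pos hord hk hc1 ht
  rw [sum_stepErr_eq_integral hF] at herr
  simp only [← heis_add, ← add_mul] at herr
  exact error_constants_le (fun N l t => beta_nonneg F N l t) (Finset.sum_nonneg fun i _ => by positivity) ht
    (sum_Icc_le_a₃_add_a₃odd (fun N l t => beta_nonneg F N l t) n τ) herr hJ

theorem traceNorm_mpf_sub_exactState_le_betaH (hF : ∀ a, IsSelfAdjoint (F a)) {ρ : E →L[ℂ] E}
    (hρ : IsDensity ρ) {n : ℕ} (hord : HasOrder F (n + 1)) {r : ℕ} {k : Fin r → ℕ}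
    (hk : ∀ i, 1 ≤ k i) {c : Fin r → ℝ} (hc1 : ∑ i, c i = 1)
    (hc0 : ∀ q ∈ Finset.Icc (n + 1) (2 * (n + 1) - 1), ∑ i, c i / (k i : ℝ) ^ q = 0)
    {t τ : ℝ} (ht : 0 ≤ t) (hτ : ∀ i, t / k i ≤ τ) (hτ0 : 0 ≤ τ) :
    traceNorm (mpf F ρ k c t - exactState F ρ t) ≤
      (∑ i, |c i| / (k i : ℝ) ^ (2 * (n + 1))) *
        (a₁ F (n + 1) * t ^ (2 * (n + 1) + 2) + a₂ (betaH F) (n + 1) τ * t ^ (2 * (n + 1) + 1) +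
          a₃ (betaH F) (n + 1) τ * t ^ (2 * (n + 1))) := by
  have hJ := norm_integral_sum_orbit_le (heis F) (heisGen F) (heis_zero F) (heis_add F)
    (hasDerivAt_heis F) (norm_heis hF) (heisGen_heis F) hk hc0
    (fun m hm => heisErrCoeff_eq_zero hF hord hm) (Z := fun s => heis F s (errOp F s)) ht hτ
    (b := fun N l => betaH F N l τ)
    (b₀ := betaH F (2 * (n + 1)) 0 0) (fun N l => betaH_nonneg _ _ _ _) (betaH_nonneg _ _ _ _)
    (fun N hN l s hs => by
      refine (norm_heisGen_pow_heis_errOp_sub_taylor_le hF l hs hN).trans ?_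
      have := hs.1
      rw [betaH_eq_add_sum]
      gcongr with j hj
      -- The coefficient terms are bounded at time zero; monotonicity raises them to `τ`, the time
      -- used in `betaH`.
      exact beta_mono hF _ _ le_rfl hτ0)
    (fun s hs => by
      rw [betaH_eq_add_sum, beta_zero_right hF _ le_rfl, ← beta_zero_right hF _ hτ0]
      exact norm_heisGen_pow_heis_errOp_sub_taylor_le hF 0 hs (by omega))
    -- The phase has been moved into `Z`, so the orbit is sampled at the left end points and only
    -- Bernoulli numbers occur.
    (θ := fun _ => 0) (fun x _ => ⟨le_rfl, zero_le_one⟩)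
    (m := fun l => |((bernoulli l : ℚ) : ℝ)|)
    (fun l _ x _ => by rw [bernoulliFun_eval_zero])
    (fun y hy => abs_bernoulliFun_div_factorial_le n.succ_pos hy)
  have herr := traceNorm_mpf_sub_exactState_le hF hρ n.succ_pos hord hk hc1 ht
  rw [sum_stepErr_eq_integral hF] at herr
  simp only [add_zero] at hJ
  exact error_constants_le (fun N l t => betaH_nonneg F N l t)
    (Finset.sum_nonneg fun i _ => by positivity) ht
    (sum_Icc_le_a₃ (fun N l t => betaH_nonneg F N l t) n τ) herr hJ

end Final

end MPF

theorem theorem1 {E : Type*} [NormedAddCommGroup E] [InnerProductSpace ℂ E]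
    [FiniteDimensional ℂ E] {d : ℕ} (F : Fin d → E →L[ℂ] E)
    (hF : ∀ a, (F a : E →ₗ[ℂ] E).IsSymmetric)
    (ρin : E →L[ℂ] E) (hρ : MPF.IsDensity ρin)
    (p : ℕ) (hp : 1 ≤ p) (hord : MPF.HasOrder F p)
    (k : Fin (p + 1) → ℕ) (hk : ∀ i, 1 ≤ k i) (c : Fin (p + 1) → ℝ)
    (hc1 : ∑ i, c i = 1)
    (hc0 : ∀ q ∈ Finset.Icc p (2 * p - 1), ∑ i, c i / (k i : ℝ) ^ q = 0)
    (t : ℝ) (ht : 0 ≤ t) :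
    MPF.traceNorm (MPF.mpf F ρin k c t - MPF.exactState F ρin t) ≤
        (∑ i, |c i| / (k i : ℝ) ^ (2 * p)) *
          (MPF.a₁ F p * t ^ (2 * p + 2)
            + MPF.a₂ (MPF.beta F) p (t / (⨅ i, k i : ℕ)) * t ^ (2 * p + 1)
            + (MPF.a₃ (MPF.beta F) p (t / (⨅ i, k i : ℕ))
                + MPF.a₃odd (MPF.beta F) p (t / (⨅ i, k i : ℕ))) * t ^ (2 * p)) ∧
      MPF.traceNorm (MPF.mpf F ρin k c t - MPF.exactState F ρin t) ≤
        (∑ i, |c i| / (k i : ℝ) ^ (2 * p)) *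
          (MPF.a₁ F p * t ^ (2 * p + 2)
            + MPF.a₂ (MPF.betaH F) p (t / (⨅ i, k i : ℕ)) * t ^ (2 * p + 1)
            + MPF.a₃ (MPF.betaH F) p (t / (⨅ i, k i : ℕ)) * t ^ (2 * p)) := by
  have : CompleteSpace E := FiniteDimensional.complete ℂ E
  have hF' : ∀ a, IsSelfAdjoint (F a) := fun a =>
    ContinuousLinearMap.isSelfAdjoint_iff_isSymmetric.2 (hF a)
  -- With `p = n + 1`, the explicit Euler–Maclaurin terms are those with `l ≤ n`, and the term `l =
  -- p` belongs to the remainder.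
  obtain ⟨n, rfl⟩ := Nat.exists_eq_succ_of_ne_zero (Nat.one_le_iff_ne_zero.1 hp)
  obtain ⟨i₀, hi₀⟩ := exists_eq_ciInf_of_finite (f := k)
  have hmin : (1 : ℝ) ≤ ((⨅ i, k i : ℕ) : ℝ) := by
    rw [← hi₀]
    exact_mod_cast hk i₀
  have hle : ∀ i, ((⨅ i, k i : ℕ) : ℝ) ≤ k i := fun i => by
    exact_mod_cast ciInf_le (OrderBot.bddBelow _) i
  have hτ : ∀ i, t / k i ≤ t / (⨅ i, k i : ℕ) := fun i =>
    div_le_div_of_nonneg_left ht (by linarith) (hle i)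
  exact ⟨MPF.traceNorm_mpf_sub_exactState_le_beta hF' hρ hord hk hc1 hc0 ht hτ (by positivity),
    MPF.traceNorm_mpf_sub_exactState_le_betaH hF' hρ hord hk hc1 hc0 ht hτ (by positivity)⟩
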